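/- Let $g\ge 1$ and let $q_i(x,y)=a_ix^2+2b_ixy+c_iy^2$ ($i=1,\dots,g$) be irreducible binary quadratic forms over $\mathbb{Z}$ with $a_i\equiv 1 \pmod 4$. Let $\delta_i=(2b_i)^2-4a_ic_i$ be the discriminant of $q_i$, let $\mathrm{Res}(q_i,q_j)$ be the resultant of $q_i$ and $q_j$, and put $$D:=\prod_{p\le 2g}p\ \prod_{k=1}^g a_kc_k\delta_k\ \prod_{i<j}\mathrm{Res}(q_i,q_j).$$ Assume that $D\ne 0$ and that $\mathbf z\in\mathbb{Z}^2$ satisfies $\gcd(q_i(\mathbf z),D)=1$ for $i=1,\dots,g$. For positive integers $d_1,\dots,d_g$ put $\mathbf d=(d_1,\dots,d_g)$, $$\Lambda_{\mathbf d}:=\{\mathbf x\in\mathbb{Z}^2: d_i\mid q_i(\mathbf x)\ (i=1,\dots,g)\},\quad \rho(\mathbf d):=\#\big(\Lambda_{\mathbf d}\cap[0,d_1\cdots d_g)^2\big),\quad \Psi:=\{\mathbf x\in\mathbb{Z}^2:\mathbf x\equiv\mathbf z \pmod D\}.$$ For real numbers $M,Q_1,\dots,Q_g\ge 1$ let $$T(M,\mathbf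 Q):=\sum_{\substack{1\le d_i\le Q_i\\ \gcd(d_i,D)=1}}\ \sup_{\mathcal R}\left|\#(\Lambda_{\mathbf d}\cap\mathcal R\cap\Psi)-\frac{\mathrm{vol}(\mathcal R)\,\rho(\mathbf d)}{(d_1\cdots d_gD)^2}\right|,$$ where the supremum is over all bounded sets $\mathcal R\subset\mathbb{R}^2$ whose topological boundary is connected (or empty) and has length (one-dimensional Hausdorff measure) at most $M$; these include all bounded convex sets with boundary of length at most $M$. Write $Q:=Q_1\cdots Q_g$. Then there exist constants $\nu_1,\nu_2>1$, depending only on $g$, such that $$T(M,\mathbf Q)\ll Q(\log 2Q)^{\nu_1}+M\sqrt Q\,(\log 2Q)^{\nu_2},$$ where the implied constant depends at most on the forms $q_1,\dots,q_g$. -/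

import Mathlib

open MeasureTheory
open scoped BigOperators ENNReal

noncomputable section

namespace LevelOfDistribution

/-- The integral binary quadratic form `a x² + 2 b x y + c y²`. -/
@[ext]
structure BinForm where
  a : ℤ
  b : ℤ
  c : ℤ

namespace BinForm

/-- The value of the form at an integer point. -/
def eval (q : BinForm) (x : ℤ × ℤ) : ℤ :=
  q.a * x.1 ^ 2 + 2 * q.b * x.1 * x.2 + q.c * x.2 ^ 2

/-- The form as a polynomial in two variables over the integers. -/
def toMvPolynomial (q : BinForm) : MvPolynomial (Fin 2) ℤ :=
  MvPolynomial.C q.a * MvPolynomial.X 0 ^ 2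
    + MvPolynomial.C (2 * q.b) * MvPolynomial.X 0 * MvPolynomial.X 1
    + MvPolynomial.C q.c * MvPolynomial.X 1 ^ 2

/-- The dehomogenised form `q(Y, 1)`. -/
def toPolynomial (q : BinForm) : Polynomial ℤ :=
  Polynomial.C q.a * Polynomial.X ^ 2 + Polynomial.C (2 * q.b) * Polynomial.X + Polynomial.C q.c

/-- The discriminant `(2b)² - 4ac`. -/
def disc (q : BinForm) : ℤ := discrim q.a (2 * q.b) q.c

/-- The resultant of two binary quadratic forms: the `4 × 4` Sylvester determinant. -/
def res (q r : BinForm) : ℤ := Polynomial.resultant q.toPolynomial r.toPolynomial 2 2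

end BinForm

/-- `D = ∏_{p ≤ 2g} p · ∏_k a_k c_k δ_k · ∏_{i < j} Res(q_i, q_j)`. -/
def bigD {g : ℕ} (q : Fin g → BinForm) : ℤ :=
  (∏ p ∈ (Finset.Icc 1 (2 * g)).filter Nat.Prime, (p : ℤ))
    * (∏ k, (q k).a * (q k).c * (q k).disc)
    * ∏ ij ∈ (Finset.univ : Finset (Fin g × Fin g)).filter (fun ij => ij.1 < ij.2),
        (q ij.1).res (q ij.2)

/-- `Λ_d`: the integer points `x` with `d_i ∣ q_i(x)` for all `i`. -/
def Lam {g : ℕ} (q : Fin g → BinForm) (d : Fin g → ℕ) : Set (ℤ × ℤ) :=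
  {x | ∀ i, (d i : ℤ) ∣ (q i).eval x}

/-- `ρ(d)`: the number of points of `Λ_d` in the box `[0, d_1 ⋯ d_g)²`. -/
def rho {g : ℕ} (q : Fin g → BinForm) (d : Fin g → ℕ) : ℕ :=
  (Lam q d ∩ Set.Ico (0 : ℤ) (∏ i, (d i : ℤ)) ×ˢ Set.Ico (0 : ℤ) (∏ i, (d i : ℤ))).ncard

/-- `Ψ`: the integer points congruent to `z` modulo `D`. -/
def Psi (D : ℤ) (z : ℤ × ℤ) : Set (ℤ × ℤ) :=
  {x | x.1 ≡ z.1 [ZMOD D] ∧ x.2 ≡ z.2 [ZMOD D]}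

/-- The integer points that lie in a subset of the Euclidean plane. -/
def latticePts (R : Set (EuclideanSpace ℝ (Fin 2))) : Set (ℤ × ℤ) :=
  {x | !₂[(x.1 : ℝ), (x.2 : ℝ)] ∈ R}

/-- The plane regions with boundary of length at most `M`: bounded sets whose topological boundary
is connected (possibly empty) and has one-dimensional Hausdorff measure at most `M`. This contains
every bounded convex set, and every region bounded by a closed Jordan curve, with boundary of
length at most `M`. -/
def regions (M : ℝ) : Set (Set (EuclideanSpace ℝ (Fin 2))) :=
  {R | Bornology.IsBounded R ∧ IsPreconnected (frontier R) ∧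
    Measure.hausdorffMeasure 1 (frontier R) ≤ ENNReal.ofReal M}

/-- `|#(Λ_d ∩ R ∩ Ψ) - vol(R) ρ(d) / (d_1 ⋯ d_g D)²|`. -/
def err {g : ℕ} (q : Fin g → BinForm) (z : ℤ × ℤ) (d : Fin g → ℕ)
    (R : Set (EuclideanSpace ℝ (Fin 2))) : ℝ :=
  |((Lam q d ∩ latticePts R ∩ Psi (bigD q) z).ncard : ℝ)
    - (volume R).toReal * (rho q d : ℝ) / ((∏ i, (d i : ℝ)) * (bigD q : ℝ)) ^ 2|

/-- The tuples of positive integers `d_i ≤ Q_i` with every `d_i` coprime to `D`. -/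
def moduli {g : ℕ} (D : ℤ) (Q : Fin g → ℝ) : Finset (Fin g → ℕ) :=
  (Fintype.piFinset fun i => Finset.Icc 1 ⌊Q i⌋₊).filter (fun d => ∀ i, IsCoprime (d i : ℤ) D)

/-- `T(M, Q)`, with values in `[0, ∞]`, so that the supremum is always the true one. -/
def T {g : ℕ} (q : Fin g → BinForm) (z : ℤ × ℤ) (M : ℝ) (Q : Fin g → ℝ) : ℝ≥0∞ :=
  ∑ d ∈ moduli (bigD q) Q, ⨆ R ∈ regions M, ENNReal.ofReal (err q z d R)

end LevelOfDistribution

end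

/-! The set `Λ_d` is not a lattice, but for `d` coprime to `D` its indicator function is a signed
sum of at most `∏ τ(d_i)²` indicators of lattices contained in `Λ_d` and periodic modulo `∏ d_i`
(`isLatticeComb_Lam`). At a prime where the discriminant is a square the form splits into two linear
factors modulo every power, and divisibility of the product is an inclusion-exclusion over how the
exponent is shared. At the other primes the condition is itself a lattice condition.

For one lattice, a reduced basis turns the count into one over `ℤ²`. The boundary length is then
multiplied by at most `2 / l`, where `l` bounds the shortest nonzero vector of `Λ_d` from below, and
a connected curve of length `L` meets at most `9L + 9` unit squares. Hence the error for `d` is `≪ ∏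
τ(d_i)² · (1 + M / l)` (`err_le`), and the first term sums to `Q` times logarithms.

For the second, `1 / l` is at most `1 / n` plus the sum of `1 / |v|` over nonzero `v ∈ Λ_d` of
height at most `n`. Exchanging summations, `v` is paired with tuples of divisors of the values
`q_i(v)`, nonzero by irreducibility. A divisor sum of `q_i(v)` is controlled by a single divisor of
size at most `√|q_i(v)| ≪ n` (`exists_dvd_sq_le`), and counting zeros of `q_i` modulo such divisors
gives `n²` times logarithms for the moments (`sum_shell_copDivisors_pow_le`). Partial summation
leaves `M n` against `M Q / n`, up to logarithms, and `n ≈ √Q` balances the two. -/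

namespace LevelOfDistribution

/-! ### Integer points in a region whose boundary is connected and short -/

/-- A connected set that leaves the unit ball around one of its points has length at least `1`
inside that ball. -/
lemma one_le_hausdorffMeasure_inter_ball {X : Type*} [MetricSpace X] [MeasurableSpace X]
    [BorelSpace X] {E : Set X} (hE : IsPreconnected E) {x y : X} (hx : x ∈ E) (hy : y ∈ E)
    (hxy : 1 ≤ dist y x) : 1 ≤ Measure.hausdorffMeasure 1 (E ∩ Metric.ball x 1) := by
  have hlip : LipschitzWith 1 (fun w : X => dist w x) := LipschitzWith.dist_left x
  have h1 := hlip.hausdorffMeasure_image_le (d := 1) zero_le_one (E ∩ Metric.ball x 1)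
  -- The distance to `x` does not increase length, and by connectedness it takes every value of `[0,
  -- 1)` on `E`, necessarily at points of the ball.
  have hsub : Set.Ico (0 : ℝ) 1 ⊆ (fun w : X => dist w x) '' (E ∩ Metric.ball x 1) := by
    intro t ht
    have := hE.intermediate_value hx hy (f := fun w : X => dist w x) hlip.continuous.continuousOn
    obtain ⟨w, hw, hwt⟩ := this (show t ∈ Set.Icc (dist x x) (dist y x) from
      ⟨by simpa using ht.1, ht.2.le.trans hxy⟩)
    refine ⟨w, ⟨hw, ?_⟩, hwt⟩
    rw [Metric.mem_ball]
    exact hwt.trans_lt ht.2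
  have h2 : (1 : ℝ≥0∞) ≤ Measure.hausdorffMeasure 1 ((fun w : X => dist w x) '' (E ∩ Metric.ball x 1)) := by
    rw [hausdorffMeasure_real]
    calc (1 : ℝ≥0∞) = volume (Set.Ico (0 : ℝ) 1) := by simp
      _ ≤ _ := measure_mono hsub
  simpa using h2.trans h1

/-- The half-open unit square with lower left corner `p`. -/
def unitCube (p : ℤ × ℤ) : Set (Fin 2 → ℝ) :=
  Set.pi Set.univ fun i => Set.Ico (![(p.1 : ℝ), (p.2 : ℝ)] i) (![(p.1 : ℝ), (p.2 : ℝ)] i + 1)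

lemma mem_unitCube {p : ℤ × ℤ} {c : Fin 2 → ℝ} :
    c ∈ unitCube p ↔ p = (⌊c 0⌋, ⌊c 1⌋) := by
  obtain ⟨a, b⟩ := p
  simp only [unitCube, Set.mem_pi, Set.mem_univ, true_implies, Fin.forall_fin_two, Set.mem_Ico,
    Prod.mk.injEq]
  simp only [Matrix.cons_val_zero, Matrix.cons_val_one]
  rw [eq_comm, Int.floor_eq_iff, @eq_comm _ b, Int.floor_eq_iff]

/-- Connectedness rules out a set made of many tiny pieces. Either `E` stays within the open unit
ball about one chosen point and meets at most nine squares, or it has length at least `1` in the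
unit ball about each chosen point. In the sup norm no point lies in more than nine of these balls.
-/
lemma card_le_of_connected {E : Set (Fin 2 → ℝ)} (hE : IsPreconnected E) {l : ℝ} (hl : 0 ≤ l)
    (hE1 : Measure.hausdorffMeasure 1 E ≤ ENNReal.ofReal l) (S : Finset (ℤ × ℤ))
    (hS : ∀ p ∈ S, (E ∩ unitCube p).Nonempty) : (S.card : ℝ) ≤ 9 * l + 9 := by
  have hS' : ∀ p : ℤ × ℤ, ∃ x, p ∈ S → x ∈ E ∧ x ∈ unitCube p := fun p => by
    by_cases h : p ∈ S
    · obtain ⟨x, h1, h2⟩ := hS p h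
      exact ⟨x, fun _ => ⟨h1, h2⟩⟩
    · exact ⟨0, fun h' => absurd h' h⟩
  choose x hx using hS'
  have near : ∀ y : Fin 2 → ℝ, ∀ p ∈ S, dist y (x p) < 1 →
      p ∈ Finset.Icc (⌊y 0⌋ - 1) (⌊y 0⌋ + 1) ×ˢ Finset.Icc (⌊y 1⌋ - 1) (⌊y 1⌋ + 1) := by
    intro y p hp hd
    have hc : ∀ i, |⌊y i⌋ - ⌊x p i⌋| ≤ 1 := by
      intro i
      have h := (dist_le_pi_dist y (x p) i).trans_lt hd
      rw [Real.dist_eq, abs_lt] at h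
      have a1 := Int.floor_le (y i)
      have a2 := Int.lt_floor_add_one (y i)
      have a3 := Int.floor_le (x p i)
      have a4 := Int.lt_floor_add_one (x p i)
      rw [abs_le]
      constructor
      · have : ((⌊x p i⌋ : ℤ) : ℝ) < ⌊y i⌋ + 2 := by linarith
        have : ⌊x p i⌋ < ⌊y i⌋ + 2 := by exact_mod_cast this
        omega
      · have : ((⌊y i⌋ : ℤ) : ℝ) < ⌊x p i⌋ + 2 := by linarith
        have : ⌊y i⌋ < ⌊x p i⌋ + 2 := by exact_mod_cast this
        omega
    have h0 := abs_le.1 (hc 0)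
    have h1 := abs_le.1 (hc 1)
    have hp' := mem_unitCube.1 (hx p hp).2
    rw [hp']
    simp only [Finset.mem_product, Finset.mem_Icc]
    omega
  have card9 : ∀ y : Fin 2 → ℝ, (Finset.Icc (⌊y 0⌋ - 1) (⌊y 0⌋ + 1) ×ˢ
      Finset.Icc (⌊y 1⌋ - 1) (⌊y 1⌋ + 1)).card = 9 := by
    intro y
    have e : ∀ n : ℤ, n + 1 + 1 - (n - 1) = 3 := fun n => by ring
    rw [Finset.card_product, Int.card_Icc, Int.card_Icc, e, e]
    rfl
  by_cases hsmall : ∃ p ∈ S, ∀ y ∈ E, dist y (x p) < 1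
  · obtain ⟨p, hp, hall⟩ := hsmall
    have : S.card ≤ 9 := by
      rw [← card9 (x p)]
      refine Finset.card_le_card fun p' hp' => near _ _ hp' ?_
      rw [dist_comm]
      exact hall _ (hx p' hp').1
    have : (S.card : ℝ) ≤ 9 := by exact_mod_cast this
    linarith
  push Not at hsmall
  have h1 : (S.card : ℝ≥0∞) ≤ ∑ p ∈ S, Measure.hausdorffMeasure 1 (E ∩ Metric.ball (x p) 1) := by
    rw [Finset.card_eq_sum_ones, Nat.cast_sum]
    refine Finset.sum_le_sum fun p hp => ?_
    obtain ⟨y, hy, hyd⟩ := hsmall p hp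
    simpa using one_le_hausdorffMeasure_inter_ball hE (hx p hp).1 hy hyd
  have h2 : ∑ p ∈ S, Measure.hausdorffMeasure 1 (E ∩ Metric.ball (x p) 1)
      ≤ 9 * Measure.hausdorffMeasure 1 E := by
    calc ∑ p ∈ S, Measure.hausdorffMeasure 1 (E ∩ Metric.ball (x p) 1)
        = ∑ p ∈ S, ∫⁻ y in E, (Metric.ball (x p) 1).indicator 1 y ∂(Measure.hausdorffMeasure 1) := by
          refine Finset.sum_congr rfl fun p _ => ?_
          rw [lintegral_indicator_one Metric.isOpen_ball.measurableSet,
            Measure.restrict_apply Metric.isOpen_ball.measurableSet, Set.inter_comm]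
      _ = ∫⁻ y in E, ∑ p ∈ S, (Metric.ball (x p) 1).indicator 1 y ∂(Measure.hausdorffMeasure 1) := by
          rw [lintegral_finsetSum]
          intro p _
          exact measurable_const.indicator Metric.isOpen_ball.measurableSet
      _ ≤ ∫⁻ _ in E, 9 ∂(Measure.hausdorffMeasure 1) := by
          refine lintegral_mono fun y => ?_
          classical
          have : ∑ p ∈ S, (Metric.ball (x p) 1).indicator (1 : (Fin 2 → ℝ) → ℝ≥0∞) y
              = ((S.filter fun p => dist y (x p) < 1).card : ℝ≥0∞) := by
            rw [Finset.card_filter, Nat.cast_sum]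
            refine Finset.sum_congr rfl fun p _ => ?_
            simp [Set.indicator_apply, Metric.mem_ball]
          rw [this]
          have h9 : (S.filter fun p => dist y (x p) < 1).card ≤ 9 := by
            rw [← card9 y]
            refine Finset.card_le_card fun p' hp' => ?_
            rw [Finset.mem_filter] at hp'
            exact near _ _ hp'.1 hp'.2
          exact le_trans (Nat.cast_le.2 h9) (by norm_num)
      _ = 9 * Measure.hausdorffMeasure 1 E := by simp
  have h3 : (S.card : ℝ≥0∞) ≤ ENNReal.ofReal (9 * l) := by
    refine h1.trans (h2.trans ?_)
    rw [ENNReal.ofReal_mul (by norm_num)]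
    gcongr
    simp
  have h4 : (S.card : ℝ) ≤ 9 * l := by
    have := ENNReal.toReal_mono ENNReal.ofReal_ne_top h3
    rwa [ENNReal.toReal_ofReal (by positivity), ENNReal.toReal_natCast] at this
  linarith

lemma measurableSet_unitCube (p : ℤ × ℤ) : MeasurableSet (unitCube p) :=
  MeasurableSet.univ_pi fun _ => measurableSet_Ico

lemma volume_unitCube (p : ℤ × ℤ) : volume (unitCube p) = 1 := by
  rw [unitCube, Real.volume_pi_Ico]
  simp

lemma isPreconnected_unitCube (p : ℤ × ℤ) : IsPreconnected (unitCube p) :=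
  (convex_pi fun _ _ => convex_Ico _ _).isPreconnected

lemma inter_frontier_nonempty_of_isPreconnected {X : Type*} [TopologicalSpace X] {s u : Set X}
    (hs : IsPreconnected s) (h1 : ∃ c ∈ s, c ∈ u) (h2 : ∃ c ∈ s, c ∉ u) :
    (s ∩ frontier u).Nonempty := by
  by_contra hne
  have hcov : s ⊆ interior u ∪ (closure u)ᶜ := by
    intro c hc
    by_contra h
    rw [Set.mem_union, not_or, Set.mem_compl_iff, not_not] at h
    exact hne ⟨c, hc, h.2, h.1⟩
  obtain ⟨c, hc, hcu⟩ := h1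
  obtain ⟨c', hc', hcu'⟩ := h2
  obtain ⟨w, -, hw1, hw2⟩ := hs _ _ isOpen_interior isClosed_closure.isOpen_compl hcov
    ⟨c, hc, (hcov hc).resolve_right fun h => h (subset_closure hcu)⟩
    ⟨c', hc', (hcov hc').resolve_left fun h => hcu' (interior_subset h)⟩
  exact hw2 (subset_closure (interior_subset hw1))

/-- Integer points in a bounded plane set with connected boundary of length at most `l`. -/
lemma abs_ncard_sub_volume_le {R : Set (Fin 2 → ℝ)} (hR : Bornology.IsBounded R)
    (hc : IsPreconnected (frontier R)) {l : ℝ} (hl : 0 ≤ l)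
    (h1 : Measure.hausdorffMeasure 1 (frontier R) ≤ ENNReal.ofReal l) :
    |(({p : ℤ × ℤ | ![(p.1 : ℝ), (p.2 : ℝ)] ∈ R}.ncard : ℕ) : ℝ) - (volume R).toReal|
      ≤ 9 * l + 9 := by
  classical
  obtain ⟨r, hr⟩ := hR.exists_norm_le
  let F : Finset (ℤ × ℤ) := Finset.Icc ⌊-r⌋ ⌊r⌋ ×ˢ Finset.Icc ⌊-r⌋ ⌊r⌋
  have hF : ∀ c ∈ R, (⌊c 0⌋, ⌊c 1⌋) ∈ F := by
    intro c hcR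
    have hn := hr c hcR
    have hi : ∀ i, -r ≤ c i ∧ c i ≤ r := fun i =>
      abs_le.1 ((Real.norm_eq_abs (c i)).symm.le.trans ((norm_le_pi_norm c i).trans hn))
    simp only [F, Finset.mem_product, Finset.mem_Icc]
    exact ⟨⟨Int.floor_mono (hi 0).1, Int.floor_mono (hi 0).2⟩,
      ⟨Int.floor_mono (hi 1).1, Int.floor_mono (hi 1).2⟩⟩
  have hself : ∀ p : ℤ × ℤ, ![(p.1 : ℝ), (p.2 : ℝ)] ∈ unitCube p := by
    intro p
    rw [mem_unitCube]
    simp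
  have hcount : ({p : ℤ × ℤ | ![(p.1 : ℝ), (p.2 : ℝ)] ∈ R}.ncard : ℝ)
      = ∑ p ∈ F, if ![(p.1 : ℝ), (p.2 : ℝ)] ∈ R then (1 : ℝ) else 0 := by
    have : {p : ℤ × ℤ | ![(p.1 : ℝ), (p.2 : ℝ)] ∈ R}
        = ↑(F.filter fun p => ![(p.1 : ℝ), (p.2 : ℝ)] ∈ R) := by
      ext p
      simp only [Set.mem_ofPred_eq, Finset.coe_filter]
      refine ⟨fun h => ⟨?_, h⟩, fun h => h.2⟩
      simpa using hF _ h
    rw [this, Set.ncard_coe_finset, Finset.card_filter]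
    push_cast
    rfl
  have hRF : R = ⋃ p ∈ F, R ∩ unitCube p := by
    ext c
    simp only [Set.mem_iUnion, Set.mem_inter_iff, exists_prop]
    exact ⟨fun h => ⟨_, hF c h, h, mem_unitCube.2 rfl⟩, fun ⟨_, _, h, _⟩ => h⟩
  have hvol : (volume R).toReal = ∑ p ∈ F, (volume (R ∩ unitCube p)).toReal := by
    rw [← ENNReal.toReal_sum]
    · congr 1
      -- `R` need not be measurable, so additivity is used for the measurable squares under the
      -- measure restricted to `R`.
      have h2 : (volume.restrict R) (⋃ p ∈ F, unitCube p) = ∑ p ∈ F, (volume.restrict R) (unitCube p) := by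
        refine measure_biUnion_finset ?_ fun p _ => measurableSet_unitCube p
        intro p _ p' _ hpp
        refine Set.disjoint_left.2 fun c hc1 hc2 => hpp ?_
        rw [mem_unitCube.1 hc1, mem_unitCube.1 hc2]
      have h3 : (volume.restrict R) (⋃ p ∈ F, unitCube p) = volume R := by
        rw [Measure.restrict_apply (F.measurableSet_biUnion fun p _ => measurableSet_unitCube p)]
        congr 1
        refine Set.inter_eq_right.2 fun c hcR => ?_
        simp only [Set.mem_iUnion, exists_prop]
        exact ⟨_, hF c hcR, mem_unitCube.2 rfl⟩
      rw [← h3, h2]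
      refine Finset.sum_congr rfl fun p _ => ?_
      rw [Measure.restrict_apply (measurableSet_unitCube p), Set.inter_comm]
    · intro p _
      refine ((measure_mono Set.inter_subset_right).trans_lt ?_).ne
      rw [volume_unitCube]
      exact ENNReal.one_lt_top
  rw [hcount, hvol, ← Finset.sum_sub_distrib]
  set S := F.filter fun p => (frontier R ∩ unitCube p).Nonempty with hSdef
  -- A connected square missed by the frontier lies wholly inside or wholly outside `R`, and then
  -- corner and area contribute equally. Every other square costs at most `1`.
  have hterm : ∀ p ∈ F, |(if ![(p.1 : ℝ), (p.2 : ℝ)] ∈ R then (1 : ℝ) else 0)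
      - (volume (R ∩ unitCube p)).toReal| ≤ if (frontier R ∩ unitCube p).Nonempty then 1 else 0 := by
    intro p _
    split_ifs with h2 h3 h4
    · have : (volume (R ∩ unitCube p)).toReal ≤ 1 := by
        refine ENNReal.toReal_le_of_le_ofReal zero_le_one ?_
        rw [ENNReal.ofReal_one, ← volume_unitCube p]
        exact measure_mono Set.inter_subset_right
      have := ENNReal.toReal_nonneg (a := volume (R ∩ unitCube p))
      rw [abs_le]; constructor <;> linarith
    · have hsub : unitCube p ⊆ R := by
        by_contra hns
        obtain ⟨c, hc1, hc2⟩ := Set.not_subset.1 hns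
        obtain ⟨w, hw⟩ := inter_frontier_nonempty_of_isPreconnected
          (isPreconnected_unitCube p) ⟨_, hself p, h2⟩ ⟨c, hc1, hc2⟩
        exact h3 ⟨w, hw.2, hw.1⟩
      rw [Set.inter_eq_right.2 hsub, volume_unitCube]
      simp
    · have : (volume (R ∩ unitCube p)).toReal ≤ 1 := by
        refine ENNReal.toReal_le_of_le_ofReal zero_le_one ?_
        rw [ENNReal.ofReal_one, ← volume_unitCube p]
        exact measure_mono Set.inter_subset_right
      have := ENNReal.toReal_nonneg (a := volume (R ∩ unitCube p))
      rw [abs_le]; constructor <;> linarith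
    · have hemp : R ∩ unitCube p = ∅ := by
        by_contra hns
        obtain ⟨c, hc1, hc2⟩ := Set.nonempty_iff_ne_empty.2 hns
        obtain ⟨w, hw⟩ := inter_frontier_nonempty_of_isPreconnected
          (isPreconnected_unitCube p) ⟨c, hc2, hc1⟩ ⟨_, hself p, h2⟩
        exact h4 ⟨w, hw.2, hw.1⟩
      rw [hemp]
      simp
  refine (Finset.abs_sum_le_sum_abs _ _).trans ((Finset.sum_le_sum hterm).trans ?_)
  rw [← Finset.sum_filter, Finset.sum_const, nsmul_eq_mul, mul_one]
  exact card_le_of_connected hc hl h1 _ fun p hp => (Finset.mem_filter.1 hp).2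

/-! ### Reduced bases and cosets of plane lattices -/

/-- The determinant of two integer vectors. -/
def cross (v w : ℤ × ℤ) : ℤ := v.1 * w.2 - v.2 * w.1

/-- The inner product of two integer vectors. -/
def dotp (v w : ℤ × ℤ) : ℤ := v.1 * w.1 + v.2 * w.2

lemma dotp_sq_add_cross_sq (v w : ℤ × ℤ) :
    dotp v w ^ 2 + cross v w ^ 2 = dotp v v * dotp w w := by
  simp only [dotp, cross]; ring

lemma dotp_self_nonneg (v : ℤ × ℤ) : 0 ≤ dotp v v := by
  simp only [dotp]; nlinarith [mul_self_nonneg v.1, mul_self_nonneg v.2]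

lemma dotp_self_pos {v : ℤ × ℤ} (hv : v ≠ 0) : 0 < dotp v v := by
  refine lt_of_le_of_ne (dotp_self_nonneg v) fun h => hv ?_
  simp only [dotp] at h
  ext
  · show v.1 = 0
    nlinarith [mul_self_nonneg v.1, mul_self_nonneg v.2]
  · show v.2 = 0
    nlinarith [mul_self_nonneg v.1, mul_self_nonneg v.2]

/-- A sublattice of `ℤ²` of finite index has a reduced basis. -/
lemma exists_reduced_basis (L : AddSubgroup (ℤ × ℤ)) (hL : L.index ≠ 0) :
    ∃ v ∈ L, ∃ w ∈ L, v ≠ 0 ∧ 0 < cross v w ∧ (∀ x ∈ L, ∃ m n : ℤ, x = m • v + n • w) ∧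
      3 * (dotp v v * dotp w w) ≤ 4 * cross v w ^ 2 ∧ dotp v v ≤ dotp w w := by
  classical
  set N : ℕ := L.index with hN
  have hmem : ∀ x : ℤ × ℤ, N • x ∈ L := fun x => L.nsmul_index_mem x
  have hN0 : 0 < N := Nat.pos_of_ne_zero hL
  -- Three successive minima pick the basis: the length of `v`, then the positive determinant
  -- against `v`, then the length of `w` among the vectors with that determinant.
  have ex1 : ∃ n : ℕ, ∃ v ∈ L, v ≠ 0 ∧ (dotp v v).toNat = n :=
    ⟨_, N • ((1 : ℤ), (0 : ℤ)), hmem _, by simpa using hN0.ne', rfl⟩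
  obtain ⟨v, hv, hv0, hvn⟩ := Nat.find_spec ex1
  have hvmin : ∀ x ∈ L, x ≠ 0 → dotp v v ≤ dotp x x := by
    intro x hx hx0
    have := Nat.find_min' ex1 ⟨x, hx, hx0, rfl⟩
    rw [← hvn] at this
    have h1 := dotp_self_nonneg v
    have h2 := dotp_self_nonneg x
    omega
  have ex2 : ∃ n : ℕ, ∃ w ∈ L, 0 < cross v w ∧ (cross v w).toNat = n := by
    have hN' : (0 : ℤ) < N := by exact_mod_cast hN0
    suffices h : ∃ w ∈ L, cross v w ≠ 0 by
      obtain ⟨w, hw, hne⟩ := h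
      rcases lt_or_gt_of_ne hne with h | h
      · refine ⟨_, -w, L.neg_mem hw, ?_, rfl⟩
        have : cross v (-w) = - cross v w := by simp [cross]; ring
        omega
      · exact ⟨_, w, hw, h, rfl⟩
    by_cases h1 : v.1 = 0
    · have h2 : v.2 ≠ 0 := fun h2 => hv0 (Prod.ext h1 h2)
      exact ⟨_, hmem (1, 0), by simp [cross, h1, h2, hN0.ne']⟩
    · exact ⟨_, hmem (0, 1), by simp [cross, h1, hN0.ne']⟩
  obtain ⟨w₀, hw₀, hw₀p, hw₀n⟩ := Nat.find_spec ex2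
  have hwmin : ∀ x ∈ L, 0 < cross v x → cross v w₀ ≤ cross v x := by
    intro x hx hx0
    have := Nat.find_min' ex2 ⟨x, hx, hx0, rfl⟩
    rw [← hw₀n] at this
    omega
  have ex3 : ∃ n : ℕ, ∃ w ∈ L, cross v w = cross v w₀ ∧ (dotp w w).toNat = n :=
    ⟨_, w₀, hw₀, rfl, rfl⟩
  obtain ⟨w, hw, hwc, hwn⟩ := Nat.find_spec ex3
  have hwmin2 : ∀ x ∈ L, cross v x = cross v w₀ → dotp w w ≤ dotp x x := by
    intro x hx hx0
    have := Nat.find_min' ex3 ⟨x, hx, hx0, rfl⟩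
    rw [← hwn] at this
    have h1 := dotp_self_nonneg w
    have h2 := dotp_self_nonneg x
    omega
  rw [← hwc] at hw₀p hwmin hwmin2
  have hw0 : w ≠ 0 := by
    rintro rfl
    simp [cross] at hw₀p
  have hred : |2 * dotp v w| ≤ dotp v v := by
    have hp := hwmin2 (w + v) (L.add_mem hw hv) (by simp [cross]; ring)
    have hm := hwmin2 (w - v) (L.sub_mem hw hv) (by simp [cross]; ring)
    have e1 : dotp (w + v) (w + v) = dotp w w + 2 * dotp v w + dotp v v := by
      simp [dotp]; ring
    have e2 : dotp (w - v) (w - v) = dotp w w - 2 * dotp v w + dotp v v := by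
      simp [dotp]; ring
    rw [abs_le]
    constructor <;> linarith
  refine ⟨v, hv, w, hw, hv0, hw₀p, ?_, ?_, hvmin w hw hw0⟩
  · intro x hx
    set n := cross v x / cross v w with hn
    have hx' : x - n • w ∈ L := L.sub_mem hx (L.zsmul_mem hw n)
    have hc' : cross v (x - n • w) = cross v x % cross v w := by
      have : cross v (x - n • w) = cross v x - cross v w * n := by simp [cross]; ring
      rw [this, Int.emod_def]
    have hc0 : cross v (x - n • w) = 0 := by
      by_contra hne
      have h1 := Int.emod_nonneg (cross v x) hw₀p.ne'
      have h2 := Int.emod_lt_of_pos (cross v x) hw₀p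
      have := hwmin _ hx' (by omega)
      omega
    set y := x - n • w with hy
    -- The nearest integer to `dotp v y / dotp v v`. The remainder is parallel to `v` and at most
    -- half as long, hence zero by minimality of `v`.
    set m := (2 * dotp v y + dotp v v) / (2 * dotp v v) with hm
    have hpos := dotp_self_pos hv0
    have hz : y - m • v ∈ L := L.sub_mem hx' (L.zsmul_mem hv m)
    have hzc : cross v (y - m • v) = 0 := by
      have : cross v (y - m • v) = cross v y := by simp [cross]; ring
      rw [this, hc0]
    have hzd : dotp v (y - m • v) = dotp v y - m * dotp v v := by simp [dotp]; ring
    have hzb : |2 * dotp v (y - m • v)| ≤ dotp v v := by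
      have h1 := Int.emod_nonneg (2 * dotp v y + dotp v v) (by positivity : 2 * dotp v v ≠ 0)
      have h2 := Int.emod_lt_of_pos (2 * dotp v y + dotp v v) (by positivity : 0 < 2 * dotp v v)
      rw [Int.emod_def, ← hm] at h1 h2
      rw [hzd, abs_le]
      constructor <;> nlinarith
    have hz0 : y - m • v = 0 := by
      by_contra hne
      have h1 := hvmin _ hz hne
      have h2 := dotp_sq_add_cross_sq v (y - m • v)
      have h3 := sq_abs (2 * dotp v (y - m • v))
      have h4 : |2 * dotp v (y - m • v)| ^ 2 ≤ dotp v v ^ 2 := by gcongr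
      rw [hzc] at h2
      nlinarith
    refine ⟨m, n, ?_⟩
    rw [← sub_eq_zero.1 hz0, hy]
    abel
  -- Lagrange's identity together with `4 (v·w)² ≤ |v|⁴ ≤ |v|² |w|²` leaves three quarters of `|v|²
  -- |w|²` below the squared determinant.
  · have h2 := dotp_sq_add_cross_sq v w
    have h3 := sq_abs (2 * dotp v w)
    have h4 : |2 * dotp v w| ^ 2 ≤ dotp v v ^ 2 := by gcongr
    have h5 := hvmin w hw hw0
    have h6 := dotp_self_nonneg v
    nlinarith

lemma index_eq_cross {L : AddSubgroup (ℤ × ℤ)} {v w : ℤ × ℤ} (hv : v ∈ L) (hw : w ∈ L)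
    (hc : 0 < cross v w) (hb : ∀ x ∈ L, ∃ m n : ℤ, x = m • v + n • w) :
    (L.index : ℤ) = cross v w := by
  have hli : LinearIndependent ℤ ![(⟨v, hv⟩ : L), ⟨w, hw⟩] := by
    rw [LinearIndependent.pair_iff]
    intro s t hst
    have h := congrArg (Subtype.val) hst
    have h1 : s * v.1 + t * w.1 = 0 := by simpa using congrArg Prod.fst h
    have h2 : s * v.2 + t * w.2 = 0 := by simpa using congrArg Prod.snd h
    have e1 : s * cross v w = 0 := by
      simp only [cross]
      linear_combination w.2 * h1 - w.1 * h2
    have e2 : t * cross v w = 0 := by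
      simp only [cross]
      linear_combination v.1 * h2 - v.2 * h1
    exact ⟨(mul_eq_zero.1 e1).resolve_right hc.ne', (mul_eq_zero.1 e2).resolve_right hc.ne'⟩
  have hsp : ⊤ ≤ Submodule.span ℤ (Set.range ![(⟨v, hv⟩ : L), ⟨w, hw⟩]) := by
    rintro ⟨x, hx⟩ -
    obtain ⟨m, n, rfl⟩ := hb x hx
    rw [Matrix.range_cons, Matrix.range_cons, Matrix.range_empty, Set.union_empty,
      Set.singleton_union, Submodule.mem_span_pair]
    exact ⟨m, n, rfl⟩
  rw [AddSubgroup.index_eq_natAbs_det (Module.Basis.finTwoProd ℤ) L (Module.Basis.mk hli hsp),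
    Module.Basis.det_apply, Matrix.det_fin_two]
  simp only [Module.Basis.toMatrix_apply, Module.Basis.mk_apply, Matrix.cons_val_zero,
    Matrix.cons_val_one, Module.Basis.coe_finTwoProd_repr]
  have : v.1 * w.2 - w.1 * v.2 = cross v w := by simp only [cross]; ring
  rw [this, Int.natCast_natAbs, abs_of_pos hc]

lemma abs_coord_le {a b s t D l : ℝ} (hl : 0 < l) (hD : 0 < D)
    (h : l ^ 2 * (s ^ 2 + t ^ 2) ≤ 4 * D ^ 2) :
    |(a * t - b * s) / D| ≤ 2 / l * √(a ^ 2 + b ^ 2) := by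
  refine abs_le_of_sq_le_sq ?_ (by positivity)
  rw [mul_pow, Real.sq_sqrt (by positivity), div_pow, div_pow, div_le_iff₀ (by positivity),
    div_mul_eq_mul_div, div_mul_eq_mul_div, le_div_iff₀ (by positivity)]
  have h1 : (a * t - b * s) ^ 2 ≤ (a ^ 2 + b ^ 2) * (s ^ 2 + t ^ 2) := by
    nlinarith [sq_nonneg (a * s + b * t)]
  have h2 := mul_le_mul_of_nonneg_right h1 (sq_nonneg l)
  have h3 := mul_le_mul_of_nonneg_left h (by positivity : 0 ≤ a ^ 2 + b ^ 2)
  nlinarith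

/-- The affine coordinate change `c ↦ o + c₀ v + c₁ w`. -/
noncomputable def frame (o v w : ℤ × ℤ) (h : 0 < cross v w) :
    (Fin 2 → ℝ) ≃ₜ EuclideanSpace ℝ (Fin 2) where
  toFun c := !₂[(o.1 : ℝ) + c 0 * v.1 + c 1 * w.1, (o.2 : ℝ) + c 0 * v.2 + c 1 * w.2]
  invFun x := ![((x 0 - o.1) * w.2 - (x 1 - o.2) * w.1) / (cross v w : ℝ),
    ((x 0 - o.1) * (-v.2) - (x 1 - o.2) * (-v.1)) / (cross v w : ℝ)]
  left_inv c := by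
    have h' : (cross v w : ℝ) ≠ 0 := by exact_mod_cast h.ne'
    have e : (cross v w : ℝ) = v.1 * w.2 - v.2 * w.1 := by simp [cross]
    ext i
    fin_cases i
    · simp
      rw [div_eq_iff h', e]; ring
    · simp
      rw [div_eq_iff h', e]; ring
  right_inv x := by
    have h' : (cross v w : ℝ) ≠ 0 := by exact_mod_cast h.ne'
    have e : (cross v w : ℝ) = v.1 * w.2 - v.2 * w.1 := by simp [cross]
    ext i
    fin_cases i
    · simp
      field_simp
      rw [e]; ring
    · simp
      field_simp
      rw [e]; ring
  continuous_toFun := by fun_prop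
  continuous_invFun := by fun_prop

/-- By Cramer's rule the two coordinates are linear forms of Euclidean norm `|w| / det` and `|v| /
det`, and the hypotheses bound both by `2 / l`. The target carries the sup norm, so the coordinates
can be treated separately. -/
lemma lipschitzWith_frame_symm {o v w : ℤ × ℤ} (h : 0 < cross v w) {l : ℝ} (hl : 0 < l)
    (hlv : l ^ 2 * (dotp v v : ℝ) ≤ 4 * (cross v w : ℝ) ^ 2)
    (hlw : l ^ 2 * (dotp w w : ℝ) ≤ 4 * (cross v w : ℝ) ^ 2) :
    LipschitzWith (Real.toNNReal (2 / l)) (frame o v w h).symm := by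
  have hD : (0 : ℝ) < cross v w := by exact_mod_cast h
  refine LipschitzWith.of_dist_le_mul fun x y => ?_
  rw [Real.coe_toNNReal _ (by positivity), EuclideanSpace.dist_eq, Fin.sum_univ_two, Real.dist_eq,
    Real.dist_eq, sq_abs, sq_abs]
  refine (dist_pi_le_iff (by positivity)).2 fun i => ?_
  fin_cases i
  · have hh : l ^ 2 * ((w.1 : ℝ) ^ 2 + (w.2 : ℝ) ^ 2) ≤ 4 * (cross v w : ℝ) ^ 2 := by
      simp only [dotp] at hlw
      push_cast at hlw
      linarith
    refine le_trans (le_of_eq ?_) (abs_coord_le (a := x 0 - y 0) (b := x 1 - y 1) hl hD hh)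
    simp only [frame, Real.dist_eq]
    simp
    rw [← sub_div]
    congr 2
    ring
  · have hh : l ^ 2 * ((-v.1 : ℝ) ^ 2 + (-v.2 : ℝ) ^ 2) ≤ 4 * (cross v w : ℝ) ^ 2 := by
      simp only [dotp] at hlv
      push_cast at hlv
      linarith
    refine le_trans (le_of_eq ?_) (abs_coord_le (a := x 0 - y 0) (b := x 1 - y 1) hl hD hh)
    simp only [frame, Real.dist_eq]
    simp
    rw [← sub_div]
    congr 2
    ring

lemma volume_frame_preimage {o v w : ℤ × ℤ} (h : 0 < cross v w)
    (R : Set (EuclideanSpace ℝ (Fin 2))) :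
    (volume (frame o v w h ⁻¹' R)).toReal = (volume R).toReal / (cross v w : ℝ) := by
  have hD : (0 : ℝ) < cross v w := by exact_mod_cast h
  let A : Matrix (Fin 2) (Fin 2) ℝ := !![(v.1 : ℝ), (w.1 : ℝ); (v.2 : ℝ), (w.2 : ℝ)]
  have hdet : LinearMap.det (Matrix.toLin' A) = (cross v w : ℝ) := by
    rw [LinearMap.det_toLin', Matrix.det_fin_two]
    simp [A, cross]
    ring
  have e : frame o v w h ⁻¹' R = Matrix.toLin' A ⁻¹'
      ((fun c => ![(o.1 : ℝ), (o.2 : ℝ)] + c) ⁻¹' ((MeasurableEquiv.toLp 2 (Fin 2 → ℝ)) ⁻¹' R)) := by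
    ext c
    simp only [Set.mem_preimage]
    refine iff_of_eq (congrArg (· ∈ R) ?_)
    ext i
    fin_cases i
    · simp [frame, A, Matrix.vecHead, Matrix.vecTail]; ring
    · simp [frame, A, Matrix.vecHead, Matrix.vecTail]; ring
  have hvol : volume ((MeasurableEquiv.toLp 2 (Fin 2 → ℝ)) ⁻¹' R) = volume R :=
    (EuclideanSpace.volume_preserving_symm_measurableEquiv_toLp (Fin 2)).symm.measure_preimage_equiv R
  rw [e, Measure.addHaar_preimage_linearMap _ (by rw [hdet]; exact hD.ne'), measure_preimage_add, hvol,
    hdet, ENNReal.toReal_mul, ENNReal.toReal_ofReal (abs_nonneg _), abs_of_pos (inv_pos.2 hD)]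
  field_simp

/-- Points of a coset of a plane lattice in a region with connected boundary. -/
lemma abs_ncard_coset_sub_le {L : AddSubgroup (ℤ × ℤ)} (hL : L.index ≠ 0) (o : ℤ × ℤ) {M l : ℝ}
    (hM : 0 ≤ M) (hl : 0 < l) (hmin : ∀ x ∈ L, x ≠ 0 → l ^ 2 ≤ (dotp x x : ℝ))
    {R : Set (EuclideanSpace ℝ (Fin 2))} (hR : R ∈ regions M) :
    |({x | x - o ∈ L ∧ x ∈ latticePts R}.ncard : ℝ) - (volume R).toReal / L.index|
      ≤ 9 * (2 / l * M) + 9 := by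
  obtain ⟨v, hv, w, hw, hv0, hc, hb, hred, hvw⟩ := exists_reduced_basis L hL
  obtain ⟨hR1, hR2, hR3⟩ := hR
  have hlv := hmin v hv hv0
  have hred' : 3 * ((dotp v v : ℝ) * dotp w w) ≤ 4 * (cross v w : ℝ) ^ 2 := by exact_mod_cast hred
  have hvw' : (dotp v v : ℝ) ≤ dotp w w := by exact_mod_cast hvw
  have hvn : (0 : ℝ) ≤ dotp v v := by exact_mod_cast dotp_self_nonneg v
  -- Since `l ≤ |v| ≤ |w|` and `|v|² |w|² ≤ (4/3) det²`, both quantities `l |v|` and `l |w|` are at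
  -- most `2 det`.
  have hlip : LipschitzWith (Real.toNNReal (2 / l)) (frame o v w hc).symm := by
    refine lipschitzWith_frame_symm hc hl ?_ ?_
    · nlinarith
    · nlinarith
  have himg : ∀ s, (frame o v w hc) ⁻¹' s = (frame o v w hc).symm '' s := fun s =>
    ((frame o v w hc).symm.image_eq_preimage_symm s).symm
  have hfr : frontier (frame o v w hc ⁻¹' R) = (frame o v w hc).symm '' frontier R := by
    rw [← Homeomorph.preimage_frontier, himg]
  have key := abs_ncard_sub_volume_le (R := frame o v w hc ⁻¹' R) (l := 2 / l * M)
    (by rw [himg]; exact hlip.isBounded_image hR1)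
    (by rw [hfr]; exact hR2.image _ (frame o v w hc).symm.continuous.continuousOn)
    (by positivity)
    (by
      rw [hfr]
      refine (hlip.hausdorffMeasure_image_le zero_le_one _).trans ?_
      rw [ENNReal.rpow_one, ENNReal.ofReal_mul (by positivity)]
      exact mul_le_mul_right hR3 _)
  rw [volume_frame_preimage] at key
  have hidx : (L.index : ℝ) = (cross v w : ℝ) := by
    rw [← index_eq_cross hv hw hc hb]; simp
  have hset : {x | x - o ∈ L ∧ x ∈ latticePts R} = (fun p : ℤ × ℤ => o + p.1 • v + p.2 • w) ''
      {p : ℤ × ℤ | ![(p.1 : ℝ), (p.2 : ℝ)] ∈ frame o v w hc ⁻¹' R} := by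
    have hcoord : ∀ p : ℤ × ℤ, frame o v w hc ![(p.1 : ℝ), (p.2 : ℝ)]
        = !₂[(((o + p.1 • v + p.2 • w).1 : ℤ) : ℝ), (((o + p.1 • v + p.2 • w).2 : ℤ) : ℝ)] := by
      intro p
      simp [frame]
    ext x
    simp only [Set.mem_image, Set.mem_preimage, Set.mem_ofPred_eq, hcoord]
    constructor
    · rintro ⟨h1, h2⟩
      obtain ⟨m, n, hmn⟩ := hb _ h1
      have hx : o + m • v + n • w = x := by rw [add_assoc, ← hmn]; abel
      refine ⟨(m, n), ?_, hx⟩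
      simp only [hx]
      exact h2
    · rintro ⟨p, hp, rfl⟩
      refine ⟨?_, hp⟩
      have : o + p.1 • v + p.2 • w - o = p.1 • v + p.2 • w := by abel
      rw [this]
      exact L.add_mem (L.zsmul_mem hv _) (L.zsmul_mem hw _)
  have hinj : Function.Injective (fun p : ℤ × ℤ => o + p.1 • v + p.2 • w) := by
    intro p p' hpp
    have h1 := congrArg Prod.fst hpp
    have h2 := congrArg Prod.snd hpp
    simp only [Prod.fst_add, Prod.snd_add, Prod.smul_fst, Prod.smul_snd, smul_eq_mul] at h1 h2
    have e1 : (p.1 - p'.1) * cross v w = 0 := by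
      simp only [cross]
      linear_combination w.2 * h1 - w.1 * h2
    have e2 : (p.2 - p'.2) * cross v w = 0 := by
      simp only [cross]
      linear_combination v.1 * h2 - v.2 * h1
    exact Prod.ext (sub_eq_zero.1 ((mul_eq_zero.1 e1).resolve_right hc.ne'))
      (sub_eq_zero.1 ((mul_eq_zero.1 e2).resolve_right hc.ne'))
  rw [hset, Set.ncard_image_of_injective _ hinj, hidx]
  exact key

/-! ### Signed combinations of lattices -/

open Classical in
/-- The indicator function of `S` is a sum of at most `B` signed indicator functions of sublattices
of `S` that are periodic modulo `N` and have index divisible by `m`. -/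
def IsLatticeComb (S : Set (ℤ × ℤ)) (N m B : ℕ) : Prop :=
  ∃ (ι : Type) (_ : Fintype ι) (ε : ι → ℤ) (L : ι → AddSubgroup (ℤ × ℤ)),
    Fintype.card ι ≤ B ∧ (∀ i, |ε i| ≤ 1) ∧ (∀ i, ∀ x ∈ L i, x ∈ S) ∧ (∀ i x, N • x ∈ L i) ∧
    (∀ i, m ∣ (L i).index) ∧
    ∀ x, (if x ∈ S then (1 : ℤ) else 0) = ∑ i, ε i * (if x ∈ L i then 1 else 0)

namespace IsLatticeComb

lemma univ : IsLatticeComb Set.univ 1 1 1 := by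
  refine ⟨Unit, inferInstance, fun _ => 1, fun _ => ⊤, ?_, ?_, ?_, ?_, ?_, ?_⟩ <;> simp

lemma of_addSubgroup {S : Set (ℤ × ℤ)} {N m B : ℕ} (L : AddSubgroup (ℤ × ℤ)) (hB : 1 ≤ B)
    (hS : ∀ x, x ∈ S ↔ x ∈ L) (hN : ∀ x, N • x ∈ L) (hm : m ∣ L.index) :
    IsLatticeComb S N m B := by
  refine ⟨Unit, inferInstance, fun _ => 1, fun _ => L, ?_, ?_, fun _ x => (hS x).2,
    fun _ => hN, fun _ => hm, ?_⟩
  · simpa using hB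
  · simp
  · intro x
    by_cases h : x ∈ L
    · simp [h, (hS x).2 h]
    · simp [h, mt (hS x).1 h]

/-- The product of the two signed sums runs over pairs of lattices, and the product of two lattice
indicators is that of the intersection. The index of an intersection is a multiple of both indices;
coprimality serves only to combine the divisors `m` and `m'`. -/
lemma inter {S S' : Set (ℤ × ℤ)} {N N' m m' B B' : ℕ} (h : IsLatticeComb S N m B)
    (h' : IsLatticeComb S' N' m' B') (hm : m.Coprime m') :
    IsLatticeComb (S ∩ S') (N * N') (m * m') (B * B') := by
  classical
  obtain ⟨ι, _, ε, L, h1, h2, h3, h4, h5, h6⟩ := h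
  obtain ⟨ι', _, ε', L', h1', h2', h3', h4', h5', h6'⟩ := h'
  refine ⟨ι × ι', inferInstance, fun i => ε i.1 * ε' i.2, fun i => L i.1 ⊓ L' i.2, ?_, ?_, ?_, ?_,
    ?_, ?_⟩
  · rw [Fintype.card_prod]
    exact Nat.mul_le_mul h1 h1'
  · intro i
    rw [abs_mul]
    exact mul_le_one₀ (h2 _) (abs_nonneg _) (h2' _)
  · intro i x hx
    exact ⟨h3 _ _ hx.1, h3' _ _ hx.2⟩
  · intro i x
    refine ⟨?_, ?_⟩
    · rw [mul_smul]
      exact h4 _ _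
    · rw [mul_comm, mul_smul]
      exact h4' _ _
  · intro i
    exact hm.mul_dvd_of_dvd_of_dvd ((h5 _).trans (AddSubgroup.index_dvd_of_le inf_le_left))
      ((h5' _).trans (AddSubgroup.index_dvd_of_le inf_le_right))
  · intro x
    trans (if x ∈ S then (1 : ℤ) else 0) * (if x ∈ S' then 1 else 0)
    · by_cases a : x ∈ S <;> by_cases b : x ∈ S' <;> simp [a, b]
    rw [h6, h6', Finset.sum_mul_sum, Fintype.sum_prod_type]
    refine Finset.sum_congr rfl fun i _ => Finset.sum_congr rfl fun j _ => ?_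
    by_cases a : x ∈ L i <;> by_cases b : x ∈ L' j <;> simp [a, b, AddSubgroup.mem_inf]

lemma mono {S : Set (ℤ × ℤ)} {N m m' B : ℕ} (h : IsLatticeComb S N m B) (hm : m' ∣ m) :
    IsLatticeComb S N m' B := by
  obtain ⟨ι, i, ε, L, h1, h2, h3, h4, h5, h6⟩ := h
  exact ⟨ι, i, ε, L, h1, h2, h3, h4, fun i => hm.trans (h5 i), h6⟩

end IsLatticeComb

/-- The integer points with `m ∣ αx + βy` and `n ∣ γx + δy`. -/
def congrLattice (α β γ δ : ℤ) (m n : ℕ) : AddSubgroup (ℤ × ℤ) where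
  carrier := {x | (m : ℤ) ∣ α * x.1 + β * x.2 ∧ (n : ℤ) ∣ γ * x.1 + δ * x.2}
  zero_mem' := by simp
  add_mem' {x y} hx hy := by
    have e1 : α * (x + y).1 + β * (x + y).2 = (α * x.1 + β * x.2) + (α * y.1 + β * y.2) := by
      simp only [Prod.fst_add, Prod.snd_add]; ring
    have e2 : γ * (x + y).1 + δ * (x + y).2 = (γ * x.1 + δ * x.2) + (γ * y.1 + δ * y.2) := by
      simp only [Prod.fst_add, Prod.snd_add]; ring
    refine ⟨?_, ?_⟩
    · rw [e1]
      exact dvd_add hx.1 hy.1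
    · rw [e2]
      exact dvd_add hx.2 hy.2
  neg_mem' {x} hx := by
    have e1 : α * (-x).1 + β * (-x).2 = -(α * x.1 + β * x.2) := by
      simp only [Prod.fst_neg, Prod.snd_neg]; ring
    have e2 : γ * (-x).1 + δ * (-x).2 = -(γ * x.1 + δ * x.2) := by
      simp only [Prod.fst_neg, Prod.snd_neg]; ring
    refine ⟨?_, ?_⟩
    · rw [e1]
      exact (dvd_neg).2 hx.1
    · rw [e2]
      exact (dvd_neg).2 hx.2

lemma mem_congrLattice {α β γ δ : ℤ} {m n : ℕ} {x : ℤ × ℤ} : x ∈ congrLattice α β γ δ m n ↔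
    (m : ℤ) ∣ α * x.1 + β * x.2 ∧ (n : ℤ) ∣ γ * x.1 + δ * x.2 := Iff.rfl

lemma nsmul_mem_congrLattice {α β γ δ : ℤ} {m n N : ℕ} (hm : m ∣ N) (hn : n ∣ N) (x : ℤ × ℤ) :
    N • x ∈ congrLattice α β γ δ m n := by
  rw [mem_congrLattice]
  simp only [nsmul_eq_mul]
  have h1 : (m : ℤ) ∣ N := by exact_mod_cast hm
  have h2 : (n : ℤ) ∣ N := by exact_mod_cast hn
  refine ⟨?_, ?_⟩
  · exact dvd_add (((h1.mul_right _)).mul_left _) ((h1.mul_right _).mul_left _)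
  · exact dvd_add (((h2.mul_right _)).mul_left _) ((h2.mul_right _).mul_left _)

/-- The lattice is the kernel of a map onto `ZMod m × ZMod n`. Surjectivity is Cramer's rule with an
inverse of the determinant modulo `m n`. -/
lemma index_congrLattice {α β γ δ : ℤ} {m n : ℕ}
    (h : IsCoprime (α * δ - β * γ) ((m : ℤ) * n)) :
    (congrLattice α β γ δ m n).index = m * n := by
  let u : ℤ × ℤ →+ ℤ := α • AddMonoidHom.fst ℤ ℤ + β • AddMonoidHom.snd ℤ ℤ
  let v : ℤ × ℤ →+ ℤ := γ • AddMonoidHom.fst ℤ ℤ + δ • AddMonoidHom.snd ℤ ℤ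
  let f : ℤ × ℤ →+ ZMod m × ZMod n :=
    ((Int.castAddHom (ZMod m)).comp u).prod ((Int.castAddHom (ZMod n)).comp v)
  have hf : ∀ x, f x = (((α * x.1 + β * x.2 : ℤ) : ZMod m), ((γ * x.1 + δ * x.2 : ℤ) : ZMod n)) := by
    intro x
    simp [f, u, v]
  have hker : congrLattice α β γ δ m n = f.ker := by
    ext x
    rw [AddMonoidHom.mem_ker, hf, Prod.mk_eq_zero, ZMod.intCast_zmod_eq_zero_iff_dvd,
      ZMod.intCast_zmod_eq_zero_iff_dvd, mem_congrLattice]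
  have hsurj : Function.Surjective f := by
    rintro ⟨s, t⟩
    obtain ⟨S, rfl⟩ := ZMod.intCast_surjective s
    obtain ⟨T, rfl⟩ := ZMod.intCast_surjective t
    obtain ⟨r, k, hrk⟩ := h
    refine ⟨(r * (δ * S - β * T), r * (α * T - γ * S)), ?_⟩
    rw [hf]
    refine Prod.ext ?_ ?_
    · rw [ZMod.intCast_eq_intCast_iff_dvd_sub]
      exact ⟨k * n * S, by linear_combination S * (-hrk)⟩
    · rw [ZMod.intCast_eq_intCast_iff_dvd_sub]
      exact ⟨k * m * T, by linear_combination T * (-hrk)⟩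
  rw [hker, AddSubgroup.index_ker, AddMonoidHom.range_eq_top.2 hsurj]
  simp [Nat.card_prod]

namespace BinForm

lemma disc_eq (q : BinForm) : q.disc = 4 * (q.b ^ 2 - q.a * q.c) := by
  simp only [disc, discrim]; ring

lemma a_mul_eval (q : BinForm) (x : ℤ × ℤ) :
    q.a * q.eval x = (q.a * x.1 + q.b * x.2) ^ 2 - (q.b ^ 2 - q.a * q.c) * x.2 ^ 2 := by
  simp only [eval]; ring

lemma eval_smul (q : BinForm) (t : ℤ) (x : ℤ × ℤ) : q.eval (t • x) = t ^ 2 * q.eval x := by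
  simp only [eval, Prod.smul_fst, Prod.smul_snd, smul_eq_mul]; ring

end BinForm

/-! ### Lattice decomposition of the zeros of a form modulo `d` -/

/-- Square roots modulo an odd prime lift to square roots modulo its powers. -/
lemma exists_sq_sub_dvd_of_prime {p : ℤ} (hp : Prime p) (h2 : ¬ p ∣ 2) {e s : ℤ} (he : ¬ p ∣ e)
    (hs : p ∣ s ^ 2 - e) (k : ℕ) : ∃ t, p ^ (k + 1) ∣ t ^ 2 - e := by
  induction k with
  | zero => exact ⟨s, by simpa using hs⟩
  | succ k ih =>
    obtain ⟨t, w, hw⟩ := ih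
    have ht : ¬ p ∣ 2 * t := by
      intro h
      have h3 := (hp.dvd_or_dvd h).resolve_left h2
      refine he ?_
      have h4 : p ∣ t ^ 2 - e := by
        rw [hw, pow_succ]
        exact (Dvd.intro_left _ rfl).mul_right _
      exact (dvd_sub_right (Dvd.dvd.pow h3 two_ne_zero)).1 h4
    obtain ⟨r, j, hrj⟩ := (hp.coprime_iff_not_dvd.2 ht)
    -- Newton's step for Hensel lifting: `p ^ (k + 1) * w` is the present error and `j` is an
    -- inverse of the derivative `2 t` modulo `p`.
    refine ⟨t - p ^ (k + 1) * (w * j), w * r + p ^ k * (w * j) ^ 2, ?_⟩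
    have e1 : (t - p ^ (k + 1) * (w * j)) ^ 2 - e
        = (t ^ 2 - e) - p ^ (k + 1) * w * (j * (2 * t)) + p ^ (k + 1) * p ^ (k + 1) * (w * j) ^ 2 := by
      ring
    have e2 : j * (2 * t) = 1 - r * p := by linear_combination hrj
    rw [e1, hw, e2]
    ring

/-- Here `α` is the `p`-adic valuation of `u` cut off at `k`, which makes sense also for `u = 0`. -/
lemma exists_le_iff_pow_dvd (p u : ℤ) (k : ℕ) :
    ∃ α ≤ k, ∀ i ≤ k, p ^ i ∣ u ↔ i ≤ α := by
  classical
  refine ⟨Nat.findGreatest (fun i => p ^ i ∣ u) k, Nat.findGreatest_le k, fun i hi => ⟨fun h =>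
    Nat.le_findGreatest hi h, fun h => ?_⟩⟩
  have := Nat.findGreatest_spec (P := fun i => p ^ i ∣ u) (m := 0) (Nat.zero_le k) (by simp)
  exact (pow_dvd_pow p h).trans this

lemma pow_dvd_mul_iff {p u v : ℤ} (hp : Prime p) {k α β : ℕ} (hα : α ≤ k) (hβ : β ≤ k)
    (h1 : ∀ i ≤ k, p ^ i ∣ u ↔ i ≤ α) (h2 : ∀ i ≤ k, p ^ i ∣ v ↔ i ≤ β) :
    p ^ k ∣ u * v ↔ k ≤ α + β := by
  have hu := (h1 α hα).2 le_rfl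
  have hv := (h2 β hβ).2 le_rfl
  constructor
  · intro h
    by_contra hlt
    push Not at hlt
    rcases succ_dvd_or_succ_dvd_of_succ_sum_dvd_mul hp hu hv
      ((pow_dvd_pow p (by omega : α + β + 1 ≤ k)).trans h) with h3 | h3
    · have := (h1 (α + 1) (by omega)).1 h3
      omega
    · have := (h2 (β + 1) (by omega)).1 h3
      omega
  · intro h
    refine (pow_dvd_pow p h).trans ?_
    rw [pow_add]
    exact mul_dvd_mul hu hv

/-- The indices counted by the first sum form an interval, and the second sum counts its pairs of
neighbours. Vertices minus edges of a path is `1`, and `0` if the path is empty. -/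
lemma sum_chain_eq {k α β : ℕ} (hα : α ≤ k) :
    (∑ i ∈ Finset.range (k + 1), (if i ≤ α ∧ k - i ≤ β then (1 : ℤ) else 0))
      - ∑ i ∈ Finset.range k, (if i + 1 ≤ α ∧ k - i ≤ β then (1 : ℤ) else 0)
      = if k ≤ α + β then 1 else 0 := by
  rw [← Finset.sum_filter, ← Finset.sum_filter, Finset.sum_const, Finset.sum_const]
  have e1 : (Finset.range (k + 1)).filter (fun i => i ≤ α ∧ k - i ≤ β) = Finset.Ico (k - β) (α + 1) := by
    ext i
    simp only [Finset.mem_filter, Finset.mem_range, Finset.mem_Ico]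
    omega
  have e2 : (Finset.range k).filter (fun i => i + 1 ≤ α ∧ k - i ≤ β) = Finset.Ico (k - β) α := by
    ext i
    simp only [Finset.mem_filter, Finset.mem_range, Finset.mem_Ico]
    omega
  rw [e1, e2, Nat.card_Ico, Nat.card_Ico]
  simp only [nsmul_eq_mul, mul_one]
  split_ifs <;> omega

/-- With `t` a square root of `b² - ac` modulo `p ^ (k + 1)`, the form `a q` is congruent to a
product `u v` of linear forms whose determinant `2 a t` is prime to `p`. The condition `p ^ k ∣ u v`
is the union over `i` of the lattices `p ^ i ∣ u`, `p ^ (k - i) ∣ v`. The lattices with sign `-1`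
are the intersections of consecutive members, and `sum_chain_eq` says that nothing else is needed.
There are `2 k + 1` lattices. -/
lemma isLatticeComb_split {p : ℕ} (hp : p.Prime) (q : BinForm) (h2 : ¬ (p : ℤ) ∣ 2)
    (ha : ¬ (p : ℤ) ∣ q.a) (hd : ¬ (p : ℤ) ∣ q.b ^ 2 - q.a * q.c) {s : ℤ}
    (hs : (p : ℤ) ∣ s ^ 2 - (q.b ^ 2 - q.a * q.c)) (k : ℕ) :
    IsLatticeComb {x | ((p ^ k : ℕ) : ℤ) ∣ q.eval x} (p ^ k) (p ^ k) ((k + 1) ^ 2) := by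
  classical
  have hp' : Prime (p : ℤ) := Nat.prime_iff_prime_int.1 hp
  obtain ⟨t, ht⟩ := exists_sq_sub_dvd_of_prime hp' h2 hd hs k
  have htp : ¬ (p : ℤ) ∣ t := fun h => hd ((dvd_sub_right (Dvd.dvd.pow h two_ne_zero)).1
    ((dvd_pow_self _ (Nat.succ_ne_zero k)).trans ht))
  have hcop : ∀ i j : ℕ, IsCoprime (q.a * (q.b + t) - (q.b - t) * q.a) (((p ^ i : ℕ) : ℤ) * (p ^ j : ℕ)) := by
    intro i j
    have h1 : ¬ (p : ℤ) ∣ 2 * q.a * t := by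
      intro h
      rcases hp'.dvd_or_dvd h with h | h
      · exact (hp'.dvd_or_dvd h).elim h2 ha
      · exact htp h
    have h3 : IsCoprime (2 * q.a * t) (p : ℤ) := (hp'.coprime_iff_not_dvd.2 h1).symm
    have e : q.a * (q.b + t) - (q.b - t) * q.a = 2 * q.a * t := by ring
    rw [e]
    push_cast
    exact (h3.pow_right).mul_right h3.pow_right
  have hmem : ∀ x : ℤ × ℤ, x ∈ {x | ((p ^ k : ℕ) : ℤ) ∣ q.eval x} ↔ (p : ℤ) ^ k ∣
      (q.a * x.1 + (q.b - t) * x.2) * (q.a * x.1 + (q.b + t) * x.2) := by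
    intro x
    have e : (q.a * x.1 + (q.b - t) * x.2) * (q.a * x.1 + (q.b + t) * x.2)
        = q.a * q.eval x - (t ^ 2 - (q.b ^ 2 - q.a * q.c)) * x.2 ^ 2 := by
      rw [BinForm.a_mul_eval]; ring
    rw [e, Set.mem_ofPred_eq, Nat.cast_pow]
    have h3 : (p : ℤ) ^ k ∣ (t ^ 2 - (q.b ^ 2 - q.a * q.c)) * x.2 ^ 2 :=
      ((pow_dvd_pow _ (Nat.le_succ k)).trans ht).mul_right _
    rw [dvd_sub_left h3]
    exact ⟨fun h => h.mul_left _, fun h =>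
      (((hp'.coprime_iff_not_dvd.2 ha).pow_left).dvd_of_dvd_mul_left h)⟩
  refine ⟨Fin (k + 1) ⊕ Fin k, inferInstance, Sum.elim (fun _ => 1) (fun _ => -1),
    Sum.elim (fun i => congrLattice q.a (q.b - t) q.a (q.b + t) (p ^ (i : ℕ)) (p ^ (k - i)))
      (fun i => congrLattice q.a (q.b - t) q.a (q.b + t) (p ^ ((i : ℕ) + 1)) (p ^ (k - i))),
    ?_, ?_, ?_, ?_, ?_, ?_⟩
  · simp only [Fintype.card_sum, Fintype.card_fin]
    nlinarith
  · rintro (i | i) <;> simp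
  · rintro (i | i) x hx
    · rw [Sum.elim_inl, mem_congrLattice] at hx
      rw [hmem, show (p : ℤ) ^ k = (p ^ (i : ℕ) : ℕ) * (p ^ (k - i) : ℕ) by
        push_cast; rw [← pow_add]; congr 1; omega]
      exact mul_dvd_mul hx.1 hx.2
    · rw [Sum.elim_inr, mem_congrLattice] at hx
      rw [hmem, show (p : ℤ) ^ k = (p ^ (i : ℕ) : ℕ) * (p ^ (k - i) : ℕ) by
        push_cast; rw [← pow_add]; congr 1; omega]
      refine mul_dvd_mul (Dvd.dvd.trans ?_ hx.1) hx.2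
      exact_mod_cast pow_dvd_pow p (Nat.le_succ i)
  · rintro (i | i) x
    · exact nsmul_mem_congrLattice (pow_dvd_pow p (by omega)) (pow_dvd_pow p (by omega)) x
    · exact nsmul_mem_congrLattice (pow_dvd_pow p (by omega)) (pow_dvd_pow p (by omega)) x
  · rintro (i | i)
    · rw [Sum.elim_inl, index_congrLattice (hcop _ _), ← pow_add]
      exact pow_dvd_pow p (by omega)
    · rw [Sum.elim_inr, index_congrLattice (hcop _ _), ← pow_add]
      exact pow_dvd_pow p (by omega)
  · intro x
    obtain ⟨α, hα, h3⟩ := exists_le_iff_pow_dvd (p : ℤ) (q.a * x.1 + (q.b - t) * x.2) k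
    obtain ⟨β, hβ, h4⟩ := exists_le_iff_pow_dvd (p : ℤ) (q.a * x.1 + (q.b + t) * x.2) k
    simp only [hmem, pow_dvd_mul_iff hp' hα hβ h3 h4]
    rw [← sum_chain_eq (β := β) hα, Fintype.sum_sum_type, Finset.sum_range, Finset.sum_range,
      sub_eq_add_neg, ← Finset.sum_neg_distrib]
    congr 1
    · refine Finset.sum_congr rfl fun i _ => ?_
      simp only [Sum.elim_inl, mem_congrLattice, Nat.cast_pow, one_mul]
      have e : ((p : ℤ) ^ (i : ℕ) ∣ q.a * x.1 + (q.b - t) * x.2 ∧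
          (p : ℤ) ^ (k - (i : ℕ)) ∣ q.a * x.1 + (q.b + t) * x.2) ↔ ((i : ℕ) ≤ α ∧ k - i ≤ β) := by
        rw [h3 _ (by omega), h4 _ (by omega)]
      simp only [e]
    · refine Finset.sum_congr rfl fun i _ => ?_
      simp only [Sum.elim_inr, mem_congrLattice, Nat.cast_pow]
      have e : ((p : ℤ) ^ ((i : ℕ) + 1) ∣ q.a * x.1 + (q.b - t) * x.2 ∧
          (p : ℤ) ^ (k - (i : ℕ)) ∣ q.a * x.1 + (q.b + t) * x.2) ↔ ((i : ℕ) + 1 ≤ α ∧ k - i ≤ β) := by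
        rw [h3 _ (by omega), h4 _ (by omega)]
      simp only [e, neg_one_mul]

/-- If the second coordinate were invertible modulo `p`, dividing by it in the completed square
would exhibit `b² - ac` as a square modulo `p`. -/
lemma dvd_of_dvd_eval_of_nonresidue {p : ℤ} (hp : Prime p) (q : BinForm) (ha : ¬ p ∣ q.a)
    (hs : ∀ s : ℤ, ¬ p ∣ s ^ 2 - (q.b ^ 2 - q.a * q.c)) {x : ℤ × ℤ} (hx : p ∣ q.eval x) :
    p ∣ x.1 ∧ p ∣ x.2 := by
  have h1 : p ∣ (q.a * x.1 + q.b * x.2) ^ 2 - (q.b ^ 2 - q.a * q.c) * x.2 ^ 2 := by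
    rw [← BinForm.a_mul_eval]
    exact hx.mul_left _
  have h2 : p ∣ x.2 := by
    by_contra h2
    obtain ⟨r, j, hrj⟩ := hp.coprime_iff_not_dvd.2 h2
    refine hs (j * (q.a * x.1 + q.b * x.2)) ?_
    obtain ⟨w, hw⟩ := h1
    have e2 : j * x.2 = 1 - r * p := by linear_combination hrj
    refine ⟨j ^ 2 * w + (q.b ^ 2 - q.a * q.c) * (r ^ 2 * p - 2 * r), ?_⟩
    have e3 : (j * (q.a * x.1 + q.b * x.2)) ^ 2 - (q.b ^ 2 - q.a * q.c)
        = j ^ 2 * ((q.a * x.1 + q.b * x.2) ^ 2 - (q.b ^ 2 - q.a * q.c) * x.2 ^ 2)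
          + (q.b ^ 2 - q.a * q.c) * ((j * x.2) ^ 2 - 1) := by ring
    rw [e3, hw, e2]
    ring
  refine ⟨?_, h2⟩
  have h3 : p ∣ (q.a * x.1 + q.b * x.2) ^ 2 :=
    (dvd_sub_left ((Dvd.dvd.pow h2 two_ne_zero).mul_left _)).1 h1
  have h4 := hp.dvd_of_dvd_pow h3
  have h5 := (dvd_add_left (h2.mul_left q.b)).1 h4
  exact (hp.dvd_or_dvd h5).resolve_left ha

/-- Descent: both coordinates are divisible by `p`, and removing that factor divides the value by
`p²`. The exponent `(k + 1) / 2` is `k / 2` rounded up. -/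
lemma pow_dvd_eval_iff_of_nonresidue {p : ℤ} (hp : Prime p) (q : BinForm) (ha : ¬ p ∣ q.a)
    (hs : ∀ s : ℤ, ¬ p ∣ s ^ 2 - (q.b ^ 2 - q.a * q.c)) (k : ℕ) (x : ℤ × ℤ) :
    p ^ k ∣ q.eval x ↔ p ^ ((k + 1) / 2) ∣ x.1 ∧ p ^ ((k + 1) / 2) ∣ x.2 := by
  constructor
  · induction k using Nat.strong_induction_on generalizing x with
    | _ k ih =>
      intro h
      match k, ih, h with
      | 0, _, _ => simp
      | 1, _, h => simpa using dvd_of_dvd_eval_of_nonresidue hp q ha hs (by simpa using h)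
      | k + 2, ih, h =>
        obtain ⟨⟨y, hy⟩, ⟨z, hz⟩⟩ := dvd_of_dvd_eval_of_nonresidue hp q ha hs
          ((dvd_pow_self p (by omega)).trans h)
        have hx : x = p • (y, z) := Prod.ext hy hz
        rw [hx, BinForm.eval_smul, pow_add, mul_comm] at h
        have h3 := ih k (by omega) (y, z) ((mul_dvd_mul_iff_left (pow_ne_zero 2 hp.ne_zero)).1 h)
        have e : (k + 2 + 1) / 2 = (k + 1) / 2 + 1 := by omega
        rw [e, pow_succ', hy, hz]
        exact ⟨mul_dvd_mul_left _ h3.1, mul_dvd_mul_left _ h3.2⟩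
  · rintro ⟨⟨y, hy⟩, ⟨z, hz⟩⟩
    have hx : x = (p ^ ((k + 1) / 2)) • (y, z) := Prod.ext hy hz
    rw [hx, BinForm.eval_smul, ← pow_mul]
    exact (pow_dvd_pow p (by omega)).mul_right _

lemma isLatticeComb_primePow {p : ℕ} (hp : p.Prime) (q : BinForm) (h2 : ¬ (p : ℤ) ∣ 2)
    (ha : ¬ (p : ℤ) ∣ q.a) (hd : ¬ (p : ℤ) ∣ q.b ^ 2 - q.a * q.c) (k : ℕ) :
    IsLatticeComb {x | ((p ^ k : ℕ) : ℤ) ∣ q.eval x} (p ^ k) (p ^ k) ((k + 1) ^ 2) := by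
  by_cases hs : ∃ s : ℤ, (p : ℤ) ∣ s ^ 2 - (q.b ^ 2 - q.a * q.c)
  · obtain ⟨s, hs⟩ := hs
    exact isLatticeComb_split hp q h2 ha hd hs k
  · push Not at hs
    refine IsLatticeComb.of_addSubgroup (congrLattice 1 0 0 1 (p ^ ((k + 1) / 2)) (p ^ ((k + 1) / 2)))
      (Nat.one_le_pow _ _ (Nat.succ_pos k)) ?_ ?_ ?_
    · intro x
      rw [mem_congrLattice, Set.mem_ofPred_eq]
      push_cast
      rw [pow_dvd_eval_iff_of_nonresidue (Nat.prime_iff_prime_int.1 hp) q ha hs]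
      simp
    · exact nsmul_mem_congrLattice (pow_dvd_pow p (by omega)) (pow_dvd_pow p (by omega))
    · rw [index_congrLattice (by simpa using isCoprime_one_left), ← pow_add]
      exact pow_dvd_pow p (by omega)

/-- The points at which a form is divisible by `d`. -/
lemma isLatticeComb_form (q : BinForm) (d : ℕ) (hd0 : d ≠ 0)
    (hd : IsCoprime (d : ℤ) (q.a * q.disc)) :
    IsLatticeComb {x | (d : ℤ) ∣ q.eval x} d d (d.divisors.card ^ 2) := by
  induction d using Nat.recOnPosPrimePosCoprime with
  | zero => exact absurd rfl hd0
  | one => simpa using IsLatticeComb.univ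
  | prime_pow p n hp hn =>
    have hp' : Prime (p : ℤ) := Nat.prime_iff_prime_int.1 hp
    have hnd : ¬ (p : ℤ) ∣ q.a * q.disc := by
      rw [← hp'.coprime_iff_not_dvd]
      rw [Nat.cast_pow] at hd
      exact (IsCoprime.pow_left_iff hn).1 hd
    rw [Nat.divisors_prime_pow hp, Finset.card_map, Finset.card_range]
    -- The discriminant carries a factor `4`, so coprimality to it also excludes `p = 2`.
    rw [BinForm.disc_eq] at hnd
    refine isLatticeComb_primePow hp q (fun h => hnd ?_) (fun h => hnd (h.mul_right _))
      (fun h => hnd ((h.mul_left _).mul_left _)) n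
    exact ((h.mul_right 2 : (p : ℤ) ∣ 2 * 2).mul_right _).mul_left _
  | coprime a b ha hb hab iha ihb =>
    rw [Nat.cast_mul, IsCoprime.mul_left_iff] at hd
    have h := (iha (by omega) hd.1).inter (ihb (by omega) hd.2) hab
    have e : {x | ((a * b : ℕ) : ℤ) ∣ q.eval x} = {x | (a : ℤ) ∣ q.eval x} ∩ {x | (b : ℤ) ∣ q.eval x} := by
      ext x
      simp only [Set.mem_inter_iff, Set.mem_ofPred_eq, Nat.cast_mul]
      exact ⟨fun h => ⟨(Dvd.intro _ rfl).trans h, (Dvd.intro_left _ rfl).trans h⟩,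
        fun h => (Nat.isCoprime_iff_coprime.2 hab).mul_dvd h.1 h.2⟩
    rw [e, hab.card_divisors_mul, mul_pow]
    exact h

/-- The set `Λ_d` is a signed sum of few lattices. -/
lemma isLatticeComb_Lam {g : ℕ} (q : Fin g → BinForm) (d : Fin g → ℕ) (hd0 : ∀ i, d i ≠ 0)
    (hd : ∀ i, IsCoprime (d i : ℤ) ((q i).a * (q i).disc)) :
    IsLatticeComb (Lam q d) (∏ i, d i) 1 (∏ i, (d i).divisors.card ^ 2) := by
  classical
  have h : ∀ s : Finset (Fin g), IsLatticeComb {x | ∀ i ∈ s, (d i : ℤ) ∣ (q i).eval x}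
      (∏ i ∈ s, d i) 1 (∏ i ∈ s, (d i).divisors.card ^ 2) := by
    intro s
    induction s using Finset.induction_on with
    | empty => simpa using IsLatticeComb.univ
    | insert i s hi ih =>
      -- Different `d i` may share primes, so the information on the index is given up before
      -- intersecting.
      have h1 := ((isLatticeComb_form (q i) (d i) (hd0 i) (hd i)).mono (one_dvd _)).inter ih
        (Nat.coprime_one_left 1)
      rw [Finset.prod_insert hi, Finset.prod_insert hi]
      have e : {x | ∀ j ∈ insert i s, (d j : ℤ) ∣ (q j).eval x}
          = {x | (d i : ℤ) ∣ (q i).eval x} ∩ {x | ∀ j ∈ s, (d j : ℤ) ∣ (q j).eval x} := by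
        ext x
        simp
      rw [e]
      exact h1
  simpa [Lam] using h Finset.univ

/-! ### Densities of periodic lattices and the error for one tuple of moduli -/

/-- The integer points of the box `[0, N)²`. -/
def box (N : ℕ) : Set (ℤ × ℤ) := Set.Ico (0 : ℤ) N ×ˢ Set.Ico (0 : ℤ) N

lemma finite_box (N : ℕ) : (box N).Finite := (Set.finite_Ico _ _).prod (Set.finite_Ico _ _)

/-- A lattice that is periodic modulo `N` has density `1 / index` in `[0, N)²`. -/
lemma ncard_inter_box_mul_index {L : AddSubgroup (ℤ × ℤ)} {N : ℕ} (hN : 0 < N)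
    (h : ∀ x, N • x ∈ L) : ((L : Set (ℤ × ℤ)) ∩ box N).ncard * L.index = N ^ 2 := by
  have : NeZero N := ⟨hN.ne'⟩
  let π : ℤ × ℤ →+ ZMod N × ZMod N := (Int.castAddHom (ZMod N)).prodMap (Int.castAddHom (ZMod N))
  have hπ : ∀ x, π x = ((x.1 : ZMod N), (x.2 : ZMod N)) := fun x => rfl
  have hsurj : Function.Surjective π := by
    rintro ⟨s, t⟩
    obtain ⟨S, rfl⟩ := ZMod.intCast_surjective s
    obtain ⟨T, rfl⟩ := ZMod.intCast_surjective t
    exact ⟨(S, T), rfl⟩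
  have hker : ∀ x y, π x = π y → x - y ∈ L := by
    intro x y hxy
    rw [hπ, hπ, Prod.mk.injEq, ZMod.intCast_eq_intCast_iff_dvd_sub,
      ZMod.intCast_eq_intCast_iff_dvd_sub] at hxy
    obtain ⟨⟨s, hs⟩, ⟨t, ht⟩⟩ := hxy
    have : x - y = -(N • ((s, t) : ℤ × ℤ)) := by
      ext
      · simp only [Prod.fst_sub, Prod.fst_neg, Prod.smul_fst]
        rw [nsmul_eq_mul]
        linarith
      · simp only [Prod.snd_sub, Prod.snd_neg, Prod.smul_snd]
        rw [nsmul_eq_mul]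
        linarith
    rw [this]
    exact L.neg_mem (h _)
  -- `L` contains the kernel of reduction modulo `N`, so it is recovered from its image, whose
  -- elements are represented exactly once in the box.
  have hcomap : (L.map π).comap π = L := by
    ext x
    rw [AddSubgroup.mem_comap, AddSubgroup.mem_map]
    constructor
    · rintro ⟨y, hy, hxy⟩
      have := L.add_mem (hker x y hxy.symm) hy
      simpa using this
    · exact fun hx => ⟨x, hx, rfl⟩
  have hidx : L.index = (L.map π).index := by
    conv_lhs => rw [← hcomap]
    exact AddSubgroup.index_comap_of_surjective _ hsurj
  have hinj : Set.InjOn π ((L : Set (ℤ × ℤ)) ∩ box N) := by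
    rintro x ⟨-, hx1, hx2⟩ y ⟨-, hy1, hy2⟩ hxy
    rw [hπ, hπ, Prod.mk.injEq, ZMod.intCast_eq_intCast_iff, ZMod.intCast_eq_intCast_iff] at hxy
    refine Prod.ext ?_ ?_
    · have := hxy.1
      rwa [Int.ModEq, Int.emod_eq_of_lt hx1.1 hx1.2, Int.emod_eq_of_lt hy1.1 hy1.2] at this
    · have := hxy.2
      rwa [Int.ModEq, Int.emod_eq_of_lt hx2.1 hx2.2, Int.emod_eq_of_lt hy2.1 hy2.2] at this
  have himg : π '' ((L : Set (ℤ × ℤ)) ∩ box N) = (L.map π : Set (ZMod N × ZMod N)) := by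
    ext c
    constructor
    · rintro ⟨x, hx, rfl⟩
      exact ⟨x, hx.1, rfl⟩
    · rintro ⟨x, hx, rfl⟩
      have hN' : (0 : ℤ) < N := by exact_mod_cast hN
      have hr : π (x.1 % N, x.2 % N) = π x := by
        rw [hπ, hπ]
        simp
      refine ⟨(x.1 % N, x.2 % N), ⟨?_, ?_⟩, hr⟩
      · have := L.add_mem (hker _ _ hr) hx
        simpa using this
      · exact ⟨⟨Int.emod_nonneg _ hN'.ne', Int.emod_lt_of_pos _ hN'⟩,
          ⟨Int.emod_nonneg _ hN'.ne', Int.emod_lt_of_pos _ hN'⟩⟩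
  rw [← hinj.ncard_image, himg, hidx, Set.ncard_def]
  have := AddSubgroup.card_mul_index (L.map π)
  rw [Nat.card_prod, Nat.card_zmod] at this
  rw [sq, ← this]
  rfl

lemma index_ne_zero_of_periodic {L : AddSubgroup (ℤ × ℤ)} {N : ℕ} (hN : 0 < N)
    (h : ∀ x, N • x ∈ L) : L.index ≠ 0 := by
  intro h0
  have := ncard_inter_box_mul_index hN h
  rw [h0, mul_zero] at this
  exact (pow_pos hN 2).ne this

lemma index_inf_of_coprime {L K : AddSubgroup (ℤ × ℤ)} (hL : L.index ≠ 0) (hK : K.index ≠ 0)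
    (h : L.index.Coprime K.index) : (L ⊓ K).index = L.index * K.index := by
  refine le_antisymm AddSubgroup.index_inf_le ?_
  exact Nat.le_of_dvd (Nat.pos_of_ne_zero (AddSubgroup.index_inf_ne_zero hL hK))
    (h.mul_dvd_of_dvd_of_dvd (AddSubgroup.index_dvd_of_le inf_le_left)
      (AddSubgroup.index_dvd_of_le inf_le_right))

open Classical in
lemma cast_ncard_inter_eq_sum {ι : Type} [Fintype ι] {S F : Set (ℤ × ℤ)} (hF : F.Finite)
    {ε : ι → ℤ} {L : ι → Set (ℤ × ℤ)}
    (h : ∀ x ∈ F, (if x ∈ S then (1 : ℤ) else 0) = ∑ i, ε i * (if x ∈ L i then 1 else 0)) :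
    ((S ∩ F).ncard : ℤ) = ∑ i, ε i * ((L i ∩ F).ncard : ℤ) := by
  have e : ∀ A : Set (ℤ × ℤ), ((A ∩ F).ncard : ℤ) = ∑ x ∈ hF.toFinset, if x ∈ A then 1 else 0 := by
    intro A
    have : A ∩ F = ↑(hF.toFinset.filter (· ∈ A)) := by
      ext x
      simp [and_comm]
    rw [this, Set.ncard_coe_finset, Finset.card_filter]
    push_cast
    rfl
  simp only [e, Finset.mul_sum]
  rw [Finset.sum_comm]
  exact Finset.sum_congr rfl fun x hx => h x (hF.mem_toFinset.1 hx)

lemma finite_latticePts {R : Set (EuclideanSpace ℝ (Fin 2))} (hR : Bornology.IsBounded R) :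
    (latticePts R).Finite := by
  obtain ⟨r, hr⟩ := hR.exists_norm_le
  refine ((Set.finite_Icc ⌊-r⌋ ⌊r⌋).prod (Set.finite_Icc ⌊-r⌋ ⌊r⌋)).subset fun x hx => ?_
  have h := hr _ hx
  have h0 := abs_le.1 ((Real.norm_eq_abs _).symm.le.trans ((PiLp.norm_apply_le _ 0).trans h))
  have h1 := abs_le.1 ((Real.norm_eq_abs _).symm.le.trans ((PiLp.norm_apply_le _ 1).trans h))
  simp only [Matrix.cons_val_zero, Matrix.cons_val_one] at h0 h1
  refine ⟨⟨?_, ?_⟩, ⟨?_, ?_⟩⟩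
  · simpa using Int.floor_mono h0.1
  · simpa using Int.floor_mono h0.2
  · simpa using Int.floor_mono h1.1
  · simpa using Int.floor_mono h1.2

/-- The error in the number of points of `Λ_d ∩ Ψ` in a region, in terms of a lower bound `l` for
the length of the nonzero points of `Λ_d`. -/
lemma err_le {g : ℕ} (q : Fin g → BinForm) (z : ℤ × ℤ) (d : Fin g → ℕ) (hd0 : ∀ i, d i ≠ 0)
    (hD : bigD q ≠ 0) (hd : ∀ i, IsCoprime (d i : ℤ) (bigD q))
    (hd' : ∀ i, IsCoprime (d i : ℤ) ((q i).a * (q i).disc)) {M l : ℝ} (hM : 0 ≤ M) (hl : 0 < l)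
    (hmin : ∀ x ∈ Lam q d, x ≠ 0 → l ^ 2 ≤ (dotp x x : ℝ))
    {R : Set (EuclideanSpace ℝ (Fin 2))} (hR : R ∈ regions M) :
    err q z d R ≤ (∏ i, ((d i).divisors.card : ℝ) ^ 2) * (9 * (2 / l * M) + 9) := by
  classical
  obtain ⟨ι, _, ε, L, hcard, hε, hLS, hper, -, hind⟩ := isLatticeComb_Lam q d hd0 hd'
  set N : ℕ := ∏ i, d i with hNdef
  set D : ℕ := (bigD q).natAbs with hDdef
  have hN : 0 < N := Finset.prod_pos fun i _ => Nat.pos_of_ne_zero (hd0 i)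
  have hD0 : 0 < D := Int.natAbs_pos.2 hD
  have hND : IsCoprime (N : ℤ) (D : ℤ) := by
    rw [hDdef, Int.natCast_natAbs, hNdef, Nat.cast_prod]
    exact IsCoprime.prod_left fun i _ => (hd i).abs_right
  have hND' : N.Coprime D := Nat.isCoprime_iff_coprime.1 hND
  obtain ⟨r, t, hrt⟩ := hND
  -- Since `r` inverts `N` modulo `D`, the point `o` is congruent to `z` modulo `D` and lies in
  -- every `L i`. One base point therefore makes every `L i ∩ Ψ` a coset of `L i ⊓ K`.
  set o : ℤ × ℤ := N • (r • z) with ho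
  set K : AddSubgroup (ℤ × ℤ) := congrLattice 1 0 0 1 D D with hK
  have hKidx : K.index = D ^ 2 := by
    rw [hK, index_congrLattice (by simpa using isCoprime_one_left), sq]
  have hoz : o - z ∈ K := by
    rw [hK, mem_congrLattice, ho]
    simp only [Prod.fst_sub, Prod.snd_sub, Prod.smul_fst, Prod.smul_snd]
    simp only [nsmul_eq_mul, smul_eq_mul]
    exact ⟨⟨-t * z.1, by linear_combination z.1 * hrt⟩, ⟨-t * z.2, by linear_combination z.2 * hrt⟩⟩
  have hPsi : ∀ x, x ∈ Psi (bigD q) z ↔ x - o ∈ K := by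
    intro x
    have e : x - z = (x - o) + (o - z) := by abel
    have h1 : x - o ∈ K ↔ x - z ∈ K := by
      rw [e]
      exact (K.add_mem_cancel_right hoz).symm
    rw [h1, hK, mem_congrLattice]
    simp only [Psi, Set.mem_ofPred_eq, Prod.fst_sub, Prod.snd_sub, hDdef, Int.natAbs_dvd, one_mul,
      zero_mul, add_zero, zero_add]
    exact and_congr (Int.modEq_comm.trans Int.modEq_iff_dvd) (Int.modEq_comm.trans Int.modEq_iff_dvd)
  have hLidx : ∀ i, (L i).index ≠ 0 := fun i => index_ne_zero_of_periodic hN (hper i)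
  have hidx : ∀ i, (L i ⊓ K).index = (L i).index * D ^ 2 := by
    intro i
    rw [← hKidx]
    refine index_inf_of_coprime (hLidx i) (by rw [hKidx]; positivity) ?_
    rw [hKidx]
    refine Nat.Coprime.coprime_dvd_left ?_ (hND'.pow 2 2)
    exact Dvd.intro_left _ (ncard_inter_box_mul_index hN (hper i))
  have hmem : ∀ i x, x - o ∈ L i ⊓ K ↔ x ∈ L i ∧ x ∈ Psi (bigD q) z := by
    intro i x
    rw [AddSubgroup.mem_inf, hPsi]
    refine and_congr_left fun _ => ?_
    exact ⟨fun h => by simpa [ho] using add_mem h (hper i (r • z)), fun h => sub_mem h (hper i _)⟩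
  have hcount : ((Lam q d ∩ latticePts R ∩ Psi (bigD q) z).ncard : ℝ)
      = ∑ i, (ε i : ℝ) * ({x | x - o ∈ L i ⊓ K ∧ x ∈ latticePts R}.ncard : ℝ) := by
    have h1 := cast_ncard_inter_eq_sum (S := Lam q d) (L := fun i => (L i : Set (ℤ × ℤ))) (ε := ε)
      (F := latticePts R ∩ Psi (bigD q) z) ((finite_latticePts hR.1).subset Set.inter_subset_left)
      (fun x _ => hind x)
    have h2 : ∀ i, {x | x - o ∈ L i ⊓ K ∧ x ∈ latticePts R}
        = (L i : Set (ℤ × ℤ)) ∩ (latticePts R ∩ Psi (bigD q) z) := by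
      intro i
      ext x
      rw [Set.mem_ofPred_eq, hmem]
      simp only [Set.mem_inter_iff, SetLike.mem_coe]
      tauto
    simp only [h2]
    rw [Set.inter_assoc]
    exact_mod_cast h1
  -- Counting the same signed sum over one period expresses the density of `Λ_d` by those of the
  -- lattices, so their main terms add up exactly to the required one.
  have hrho : (rho q d : ℝ) / (N : ℝ) ^ 2 = ∑ i, (ε i : ℝ) / ((L i).index : ℝ) := by
    have h1 := cast_ncard_inter_eq_sum (S := Lam q d) (L := fun i => (L i : Set (ℤ × ℤ))) (ε := ε)
      (finite_box N) (fun x _ => hind x)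
    have h2 : rho q d = (Lam q d ∩ box N).ncard := by
      rw [rho, box, hNdef]
      push_cast
      rfl
    have h3 : (rho q d : ℝ) = ∑ i, (ε i : ℝ) * (((L i : Set (ℤ × ℤ)) ∩ box N).ncard : ℝ) := by
      rw [h2]
      exact_mod_cast h1
    rw [h3, Finset.sum_div]
    refine Finset.sum_congr rfl fun i _ => ?_
    have h4 : ((((L i : Set (ℤ × ℤ)) ∩ box N).ncard : ℝ)) * ((L i).index : ℝ) = (N : ℝ) ^ 2 := by
      exact_mod_cast ncard_inter_box_mul_index hN (hper i)
    have h5 : ((L i).index : ℝ) ≠ 0 := by exact_mod_cast hLidx i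
    have h6 : (N : ℝ) ≠ 0 := by exact_mod_cast hN.ne'
    rw [div_eq_div_iff (by positivity) h5, ← h4]
    ring
  have hmain : (volume R).toReal * (rho q d : ℝ) / ((∏ i, (d i : ℝ)) * (bigD q : ℝ)) ^ 2
      = ∑ i, (ε i : ℝ) * ((volume R).toReal / ((L i ⊓ K).index : ℝ)) := by
    have e1 : ((∏ i, (d i : ℝ)) * (bigD q : ℝ)) ^ 2 = (N : ℝ) ^ 2 * (D : ℝ) ^ 2 := by
      rw [mul_pow, hNdef, Nat.cast_prod, hDdef, Nat.cast_natAbs]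
      push_cast
      rw [sq_abs]
    have e2 : (volume R).toReal * (rho q d : ℝ) / ((N : ℝ) ^ 2 * (D : ℝ) ^ 2)
        = (volume R).toReal / (D : ℝ) ^ 2 * ((rho q d : ℝ) / (N : ℝ) ^ 2) := by
      rw [div_mul_div_comm, mul_comm ((N : ℝ) ^ 2)]
    rw [e1, e2, hrho, Finset.mul_sum]
    refine Finset.sum_congr rfl fun i _ => ?_
    rw [hidx]
    push_cast
    rw [div_mul_div_comm, mul_div_assoc', mul_comm (ε i : ℝ), mul_comm ((D : ℝ) ^ 2)]
  have hterm : ∀ i, |(ε i : ℝ) * ({x | x - o ∈ L i ⊓ K ∧ x ∈ latticePts R}.ncard : ℝ)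
      - (ε i : ℝ) * ((volume R).toReal / ((L i ⊓ K).index : ℝ))| ≤ 9 * (2 / l * M) + 9 := by
    intro i
    rw [← mul_sub, abs_mul]
    have h1 : |(ε i : ℝ)| ≤ 1 := by exact_mod_cast hε i
    have h2 := abs_ncard_coset_sub_le (L := L i ⊓ K)
      (by rw [hidx]; exact mul_ne_zero (hLidx i) (by positivity)) o hM hl
      (fun x hx hx0 => hmin x (hLS i x hx.1) hx0) hR
    calc _ ≤ 1 * (9 * (2 / l * M) + 9) := mul_le_mul h1 h2 (abs_nonneg _) zero_le_one
      _ = _ := one_mul _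
  rw [err, hcount, hmain, ← Finset.sum_sub_distrib]
  refine (Finset.abs_sum_le_sum_abs _ _).trans ((Finset.sum_le_sum fun i _ => hterm i).trans ?_)
  rw [Finset.sum_const, Finset.card_univ, nsmul_eq_mul]
  refine mul_le_mul_of_nonneg_right ?_ (by positivity)
  exact_mod_cast hcard

/-! ### Moments of the divisor function and reduction to small divisors -/

lemma card_divisors_mul_le (a b : ℕ) : (a * b).divisors.card ≤ a.divisors.card * b.divisors.card := by
  rw [Nat.divisors_mul]
  exact Finset.card_mul_le

lemma one_le_card_divisors {n : ℕ} (hn : n ≠ 0) : 1 ≤ n.divisors.card :=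
  Finset.card_pos.2 ⟨1, Nat.one_mem_divisors.2 hn⟩

/-- Moments of the divisor function with harmonic weights. -/
lemma sum_card_divisors_pow_div_le (c N : ℕ) :
    ∑ n ∈ Finset.Icc 1 N, (n.divisors.card : ℝ) ^ c / n ≤ (1 + Real.log N) ^ (2 ^ c) := by
  induction c with
  | zero =>
    have h := harmonic_le_one_add_log N
    rw [harmonic_eq_sum_Icc] at h
    push_cast at h
    simpa [one_div] using h
  | succ c ih =>
    set F : ℕ → ℝ := fun n => (n.divisors.card : ℝ) ^ c / n with hF
    have hF0 : ∀ n, 0 ≤ F n := fun n => by positivity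
    -- One factor `τ(n)` is written as the number of factorizations `n = a b`, and the rest is
    -- submultiplicative. Summing over `n` gives at most the square of the previous moment, whence
    -- the exponent `2 ^ c`.
    have h1 : ∀ n ∈ Finset.Icc 1 N, (n.divisors.card : ℝ) ^ (c + 1) / n
        ≤ ∑ p ∈ (Finset.Icc 1 N ×ˢ Finset.Icc 1 N).filter (fun p => p.1 * p.2 = n), F p.1 * F p.2 := by
      intro n hn
      rw [Finset.mem_Icc] at hn
      have hsub : n.divisorsAntidiagonal
          ⊆ (Finset.Icc 1 N ×ˢ Finset.Icc 1 N).filter (fun p => p.1 * p.2 = n) := by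
        intro p hp
        rw [Nat.mem_divisorsAntidiagonal] at hp
        have ha : p.1 ≠ 0 := fun h => hp.2 (by rw [← hp.1, h, zero_mul])
        have hb : p.2 ≠ 0 := fun h => hp.2 (by rw [← hp.1, h, mul_zero])
        simp only [Finset.mem_filter, Finset.mem_product, Finset.mem_Icc]
        refine ⟨⟨⟨by omega, ?_⟩, ⟨by omega, ?_⟩⟩, hp.1⟩
        · exact (Nat.le_mul_of_pos_right _ (by omega)).trans (hp.1.le.trans hn.2)
        · exact (Nat.le_mul_of_pos_left _ (by omega)).trans (hp.1.le.trans hn.2)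
      refine le_trans ?_ (Finset.sum_le_sum_of_subset_of_nonneg hsub fun p _ _ =>
        mul_nonneg (hF0 _) (hF0 _))
      have h2 : (n.divisors.card : ℝ) ^ (c + 1) / n
          = ∑ _p ∈ n.divisorsAntidiagonal, (n.divisors.card : ℝ) ^ c / n := by
        rw [Finset.sum_const, ← Nat.map_div_right_divisors, Finset.card_map, nsmul_eq_mul]
        ring
      rw [h2]
      refine Finset.sum_le_sum fun p hp => ?_
      rw [Nat.mem_divisorsAntidiagonal] at hp
      simp only [hF]
      rw [div_mul_div_comm, ← mul_pow, ← hp.1]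
      push_cast
      gcongr
      exact_mod_cast card_divisors_mul_le p.1 p.2
    calc ∑ n ∈ Finset.Icc 1 N, (n.divisors.card : ℝ) ^ (c + 1) / n
        ≤ ∑ n ∈ Finset.Icc 1 N, ∑ p ∈ (Finset.Icc 1 N ×ˢ Finset.Icc 1 N).filter
            (fun p => p.1 * p.2 = n), F p.1 * F p.2 := Finset.sum_le_sum h1
      _ ≤ ∑ p ∈ Finset.Icc 1 N ×ˢ Finset.Icc 1 N, F p.1 * F p.2 :=
          Finset.sum_fiberwise_le_sum_of_sum_fiber_nonneg fun n _ =>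
            Finset.sum_nonneg fun p _ => mul_nonneg (hF0 _) (hF0 _)
      _ = (∑ n ∈ Finset.Icc 1 N, F n) ^ 2 := by
          rw [sq, Finset.sum_mul_sum, Finset.sum_product]
      _ ≤ ((1 + Real.log N) ^ (2 ^ c)) ^ 2 :=
          pow_le_pow_left₀ (Finset.sum_nonneg fun n _ => hF0 n) ih 2
      _ = (1 + Real.log N) ^ (2 ^ (c + 1)) := by rw [← pow_mul, pow_succ]

lemma sum_card_divisors_pow_le (c N : ℕ) :
    ∑ n ∈ Finset.Icc 1 N, (n.divisors.card : ℝ) ^ c ≤ N * (1 + Real.log N) ^ (2 ^ c) := by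
  refine le_trans ?_ (mul_le_mul_of_nonneg_left (sum_card_divisors_pow_div_le c N) N.cast_nonneg)
  rw [Finset.mul_sum]
  refine Finset.sum_le_sum fun n hn => ?_
  rw [Finset.mem_Icc] at hn
  have hn0 : (0 : ℝ) < n := by exact_mod_cast hn.1
  have hnN : (n : ℝ) ≤ N := by exact_mod_cast hn.2
  rw [mul_div_assoc', le_div_iff₀ hn0, mul_comm]
  gcongr

/-- Every positive integer splits into two factors each of which has many divisors. -/
lemma exists_balanced_factorization (n : ℕ) (hn : n ≠ 0) :
    ∃ d e, d * e = n ∧ n.divisors.card ≤ 2 * d.divisors.card ^ 4 ∧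
      n.divisors.card ≤ 2 * e.divisors.card ^ 4 := by
  induction n using Nat.recOnPrimePow with
  | zero => exact absurd rfl hn
  | one => exact ⟨1, 1, by simp⟩
  | prime_pow_mul a p k hp hpa hk ih =>
    have ha : a ≠ 0 := by rintro rfl; simp at hpa
    have hcop : ∀ {j b : ℕ}, b ∣ a → (p ^ j).Coprime b := fun hb =>
      Nat.Coprime.pow_left _ ((Nat.Prime.coprime_iff_not_dvd hp).2 fun h => hpa (h.trans hb))
    have hpow : ∀ j, (p ^ j).divisors.card = j + 1 := fun j => by
      rw [Nat.divisors_prime_pow hp, Finset.card_map, Finset.card_range]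
    have hmul : ∀ {j b : ℕ}, b ∣ a → (p ^ j * b).divisors.card = (j + 1) * b.divisors.card := fun hb => by
      rw [(hcop hb).card_divisors_mul, hpow]
    obtain ⟨d, e, hde, hd, he⟩ := ih ha
    have hda : d ∣ a := ⟨e, hde.symm⟩
    have hea : e ∣ a := ⟨d, by rw [mul_comm, hde]⟩
    rcases Nat.lt_or_ge k 2 with hk2 | hk2
    · obtain rfl : k = 1 := by omega
      -- A simple prime factor goes to the part `x` with fewer divisors. The other part satisfies
      -- `τ(y)² ≥ τ(x) τ(y) ≥ τ(a)` and can afford the doubling.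
      have key : ∀ x y : ℕ, x ∣ a → y ∣ a → x * y = a → a.divisors.card ≤ 2 * x.divisors.card ^ 4 →
          x.divisors.card ≤ y.divisors.card →
          (p ^ 1 * a).divisors.card ≤ 2 * (p ^ 1 * x).divisors.card ^ 4 ∧
          (p ^ 1 * a).divisors.card ≤ 2 * y.divisors.card ^ 4 := by
        intro x y hx hy hxy h1 h2
        rw [hmul dvd_rfl, hmul hx]
        refine ⟨?_, ?_⟩
        · calc (1 + 1) * a.divisors.card ≤ (1 + 1) ^ 4 * (2 * x.divisors.card ^ 4) := by
                have : a.divisors.card ≤ 2 * x.divisors.card ^ 4 := h1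
                omega
            _ = _ := by ring
        · have hy1 : 1 ≤ y.divisors.card := one_le_card_divisors (by rintro rfl; simp at hy; exact ha hy)
          have h3 : a.divisors.card ≤ y.divisors.card ^ 2 := by
            rw [← hxy, sq]
            exact (card_divisors_mul_le x y).trans (Nat.mul_le_mul_right _ h2)
          have h4 : y.divisors.card ^ 2 ≤ y.divisors.card ^ 4 := Nat.pow_le_pow_right hy1 (by norm_num)
          omega
      rcases le_total d.divisors.card e.divisors.card with h | h
      · obtain ⟨h1, h2⟩ := key d e hda hea hde hd h
        exact ⟨p ^ 1 * d, e, by rw [mul_assoc, hde], h1, h2⟩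
      · obtain ⟨h1, h2⟩ := key e d hea hda (by rw [mul_comm, hde]) he h
        exact ⟨d, p ^ 1 * e, by rw [← hde]; ring, h2, h1⟩
    -- A higher prime power is halved; both halves have exponent at least `1`.
    · have key : ∀ j x : ℕ, x ∣ a → 1 ≤ j → k ≤ 2 * j + 1 → a.divisors.card ≤ 2 * x.divisors.card ^ 4 →
          (p ^ k * a).divisors.card ≤ 2 * (p ^ j * x).divisors.card ^ 4 := by
        intro j x hx hj hkj h1
        rw [hmul dvd_rfl, hmul hx, mul_pow]
        have h2 : k + 1 ≤ (j + 1) ^ 4 := by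
          have h3 : 2 ≤ (j + 1) ^ 3 := by
            calc 2 ≤ (1 + 1) ^ 3 := by norm_num
              _ ≤ (j + 1) ^ 3 := Nat.pow_le_pow_left (by omega) 3
          calc k + 1 ≤ (j + 1) * 2 := by omega
            _ ≤ (j + 1) * (j + 1) ^ 3 := Nat.mul_le_mul_left _ h3
            _ = (j + 1) ^ 4 := by ring
        calc (k + 1) * a.divisors.card ≤ (j + 1) ^ 4 * (2 * x.divisors.card ^ 4) := Nat.mul_le_mul h2 h1
          _ = _ := by ring
      refine ⟨p ^ (k / 2) * d, p ^ (k - k / 2) * e, ?_, key _ _ hda (by omega) (by omega) hd,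
        key _ _ hea (by omega) (by omega) he⟩
      rw [← hde, mul_mul_mul_comm, ← pow_add]
      congr 2
      omega

/-- The smaller part of a balanced factorization. It replaces `τ(n)` by a power of `τ` at a divisor
up to `√n`, a range where congruence conditions on the values of a form can still be counted. -/
lemma exists_dvd_sq_le (n : ℕ) (hn : n ≠ 0) :
    ∃ d, d ∣ n ∧ d ^ 2 ≤ n ∧ n.divisors.card ≤ 2 * d.divisors.card ^ 4 := by
  obtain ⟨d, e, hde, hd, he⟩ := exists_balanced_factorization n hn
  rcases le_total d e with h | h
  · exact ⟨d, ⟨e, hde.symm⟩, by rw [sq, ← hde]; exact Nat.mul_le_mul_left _ h, hd⟩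
  · exact ⟨e, ⟨d, by rw [mul_comm, hde]⟩, by rw [sq, ← hde]; exact Nat.mul_le_mul_right _ h, he⟩

open Classical in
/-- The divisors of `n` that are coprime to `D`. -/
noncomputable def copDivisors (D : ℤ) (n : ℕ) : Finset ℕ :=
  n.divisors.filter fun d => IsCoprime (d : ℤ) D

lemma mem_copDivisors {D : ℤ} {n d : ℕ} :
    d ∈ copDivisors D n ↔ (d ∣ n ∧ n ≠ 0) ∧ IsCoprime (d : ℤ) D := by
  classical
  rw [copDivisors, Finset.mem_filter, Nat.mem_divisors]

/-- Among the divisors of `n` coprime to `D` there is a largest one for divisibility. -/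
lemma exists_copDivisors_eq (D : ℤ) {n : ℕ} (hn : n ≠ 0) :
    ∃ m ∈ copDivisors D n, ∀ d ∈ copDivisors D n, d ∣ m := by
  classical
  have hne : (copDivisors D n).Nonempty :=
    ⟨1, mem_copDivisors.2 ⟨⟨one_dvd _, hn⟩, by simpa using isCoprime_one_left⟩⟩
  obtain ⟨m, hm, hmax⟩ := Finset.exists_max_image _ id hne
  refine ⟨m, hm, fun d hd => ?_⟩
  rw [mem_copDivisors] at hm hd
  have hl : Nat.lcm m d ∈ copDivisors D n := by
    refine mem_copDivisors.2 ⟨⟨Nat.lcm_dvd hm.1.1 hd.1.1, hn⟩, ?_⟩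
    have h := IsCoprime.mul_left hm.2 hd.2
    refine IsCoprime.of_isCoprime_of_dvd_left h ?_
    exact_mod_cast Nat.lcm_dvd_mul m d
  have h1 := hmax _ hl
  have hlpos : 0 < Nat.lcm m d :=
    Nat.pos_of_ne_zero fun h0 => hn (by
      have := (mem_copDivisors.1 hl).1.1
      rw [h0] at this
      exact Nat.eq_zero_of_zero_dvd this)
  have h2 : Nat.lcm m d = m := le_antisymm h1 (Nat.le_of_dvd hlpos (Nat.dvd_lcm_left m d))
  rw [← h2]
  exact Nat.dvd_lcm_right m d

/-- Powers of divisor sums are dominated by sums over divisors up to the square root. -/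
lemma sum_copDivisors_pow_le (D : ℤ) {n : ℕ} (hn : n ≠ 0) (g : ℕ) :
    (∑ d ∈ copDivisors D n, (d.divisors.card : ℝ) ^ 2) ^ g
      ≤ 2 ^ (3 * g) * ∑ e ∈ (copDivisors D n).filter (fun e => e ^ 2 ≤ n),
          (e.divisors.card : ℝ) ^ (12 * g) := by
  obtain ⟨m, hm, hmax⟩ := exists_copDivisors_eq D hn
  have hm' := mem_copDivisors.1 hm
  have hm0 : m ≠ 0 := fun h0 => hn (Nat.eq_zero_of_zero_dvd (h0 ▸ hm'.1.1))
  -- All admissible divisors divide `m`, so there are at most `τ(m)` terms, each at most `τ(m)²`.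
  -- With `τ(m) ≤ 2 τ(e)⁴` the `g`-th power produces `2 ^ (3 * g)` and the exponent `12 * g`.
  have h1 : ∑ d ∈ copDivisors D n, (d.divisors.card : ℝ) ^ 2 ≤ (m.divisors.card : ℝ) ^ 3 := by
    have hcard : (copDivisors D n).card ≤ m.divisors.card :=
      Finset.card_le_card fun d hd => Nat.mem_divisors.2 ⟨hmax d hd, hm0⟩
    calc ∑ d ∈ copDivisors D n, (d.divisors.card : ℝ) ^ 2
        ≤ ∑ _d ∈ copDivisors D n, (m.divisors.card : ℝ) ^ 2 := by
          refine Finset.sum_le_sum fun d hd => ?_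
          gcongr
          exact hmax d hd
      _ = (copDivisors D n).card * (m.divisors.card : ℝ) ^ 2 := by
          rw [Finset.sum_const, nsmul_eq_mul]
      _ ≤ m.divisors.card * (m.divisors.card : ℝ) ^ 2 := by gcongr
      _ = _ := by ring
  obtain ⟨e, he, hem, hcard⟩ := exists_dvd_sq_le m hm0
  have he' : e ∈ (copDivisors D n).filter (fun e => e ^ 2 ≤ n) := by
    rw [Finset.mem_filter, mem_copDivisors]
    refine ⟨⟨⟨he.trans hm'.1.1, hn⟩, ?_⟩, hem.trans (Nat.le_of_dvd (Nat.pos_of_ne_zero hn) hm'.1.1)⟩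
    refine IsCoprime.of_isCoprime_of_dvd_left hm'.2 ?_
    exact_mod_cast he
  have hcard' : (m.divisors.card : ℝ) ≤ 2 * (e.divisors.card : ℝ) ^ 4 := by exact_mod_cast hcard
  calc (∑ d ∈ copDivisors D n, (d.divisors.card : ℝ) ^ 2) ^ g
      ≤ ((m.divisors.card : ℝ) ^ 3) ^ g := by gcongr
    _ ≤ ((2 * (e.divisors.card : ℝ) ^ 4) ^ 3) ^ g := by gcongr
    _ = 2 ^ (3 * g) * (e.divisors.card : ℝ) ^ (12 * g) := by
        rw [← pow_mul, mul_pow, ← pow_mul]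
        ring_nf
    _ ≤ _ := by
        gcongr
        exact Finset.single_le_sum (f := fun e : ℕ => (e.divisors.card : ℝ) ^ (12 * g))
          (fun _ _ => by positivity) he'

/-! ### Divisor moments over the values of a form -/

/-- The sup norm of an integer vector. -/
def height (v : ℤ × ℤ) : ℕ := max v.1.natAbs v.2.natAbs

lemma height_eq_zero {v : ℤ × ℤ} : height v = 0 ↔ v = 0 := by
  simp only [height, Nat.max_eq_zero_iff, Int.natAbs_eq_zero]
  exact ⟨fun h => Prod.ext h.1 h.2, fun h => by simp [h]⟩

lemma height_sq_le_dotp (v : ℤ × ℤ) : ((height v : ℤ)) ^ 2 ≤ dotp v v := by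
  simp only [height, dotp]
  rcases max_cases v.1.natAbs v.2.natAbs with ⟨h, -⟩ | ⟨h, -⟩ <;>
    rw [h, Int.natAbs_sq] <;> nlinarith [mul_self_nonneg v.1, mul_self_nonneg v.2]

/-- The nonzero integer vectors of sup norm at most `n`. -/
noncomputable def shell (n : ℕ) : Finset (ℤ × ℤ) :=
  (Finset.Icc (-n : ℤ) n ×ˢ Finset.Icc (-n : ℤ) n).erase 0

lemma mem_shell {n : ℕ} {v : ℤ × ℤ} : v ∈ shell n ↔ v ≠ 0 ∧ height v ≤ n := by
  simp only [shell, Finset.mem_erase, Finset.mem_product, Finset.mem_Icc, height, max_le_iff]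
  refine and_congr_right fun _ => ?_
  omega

namespace BinForm

/-- The sum of the absolute values of the coefficients. -/
def size (q : BinForm) : ℕ := q.a.natAbs + 2 * q.b.natAbs + q.c.natAbs

lemma natAbs_eval_le (q : BinForm) (v : ℤ × ℤ) : (q.eval v).natAbs ≤ q.size * height v ^ 2 := by
  have h1 : v.1.natAbs ≤ height v := le_max_left _ _
  have h2 : v.2.natAbs ≤ height v := le_max_right _ _
  rw [eval]
  refine (Int.natAbs_add_le _ _).trans ((Nat.add_le_add_right (Int.natAbs_add_le _ _) _).trans ?_)
  simp only [Int.natAbs_mul, Int.natAbs_pow, size]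
  calc _ ≤ q.a.natAbs * height v ^ 2 + (2 : ℤ).natAbs * q.b.natAbs * height v * height v
        + q.c.natAbs * height v ^ 2 := by gcongr
    _ = _ := by
      rw [show (2 : ℤ).natAbs = 2 from rfl]
      ring

/-- An irreducible form has no nontrivial zeros, if its outer coefficients do not vanish. -/
lemma eval_ne_zero {q : BinForm} (hq : Irreducible q.toMvPolynomial) (ha : q.a ≠ 0) (hc : q.c ≠ 0)
    {v : ℤ × ℤ} (hv : v ≠ 0) : q.eval v ≠ 0 := by
  intro h0
  obtain ⟨x, y, hxy, hxy0⟩ : ∃ x y : ℤ, IsCoprime x y ∧ q.eval (x, y) = 0 := by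
    have hg : 0 < Int.gcd v.1 v.2 := by
      refine Nat.pos_of_ne_zero fun h => hv ?_
      rw [Int.gcd_eq_zero_iff] at h
      exact Prod.ext h.1 h.2
    obtain ⟨x, y, hc, h1, h2⟩ := Int.exists_gcd_one hg
    refine ⟨x, y, Int.isCoprime_iff_gcd_eq_one.2 hc, ?_⟩
    have hv' : v = (Int.gcd v.1 v.2 : ℤ) • (x, y) := by
      refine Prod.ext ?_ ?_
      · rw [Prod.smul_fst, smul_eq_mul, mul_comm]; exact h1
      · rw [Prod.smul_snd, smul_eq_mul, mul_comm]; exact h2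
    rw [hv', eval_smul] at h0
    have : ((Int.gcd v.1 v.2 : ℕ) : ℤ) ≠ 0 := by exact_mod_cast hg.ne'
    exact (mul_eq_zero.1 h0).resolve_left (pow_ne_zero 2 this)
  simp only [eval] at hxy0
  have hx0 : x ≠ 0 := by
    rintro rfl
    have hy : y ≠ 0 := by
      rintro rfl
      exact not_isCoprime_zero_zero hxy
    have : q.c * y ^ 2 = 0 := by linear_combination hxy0
    exact hc ((mul_eq_zero.1 this).resolve_right (pow_ne_zero 2 hy))
  have hy0 : y ≠ 0 := by
    rintro rfl
    have : q.a * x ^ 2 = 0 := by linear_combination hxy0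
    exact ha ((mul_eq_zero.1 this).resolve_right (pow_ne_zero 2 hx0))
  -- A primitive zero `(x, y)` forces `y ∣ a` and `x ∣ c`, which yields a factorization over `ℤ`
  -- itself. Neither factor is a unit, since both vanish at the origin.
  obtain ⟨a', ha'⟩ : y ∣ q.a := by
    refine (hxy.symm.pow_right (n := 2)).dvd_of_dvd_mul_right ?_
    exact ⟨-(2 * q.b * x + q.c * y), by linear_combination hxy0⟩
  obtain ⟨c', hc'⟩ : x ∣ q.c := by
    refine (hxy.pow_right (n := 2)).dvd_of_dvd_mul_right ?_
    exact ⟨-(2 * q.b * y + q.a * x), by linear_combination hxy0⟩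
  have hb : 2 * q.b = -(a' * x + c' * y) := by
    have : x * y * (2 * q.b + (a' * x + c' * y)) = 0 := by
      rw [ha', hc'] at hxy0
      linear_combination hxy0
    have := (mul_eq_zero.1 this).resolve_left (mul_ne_zero hx0 hy0)
    linarith
  have hfac : q.toMvPolynomial = (MvPolynomial.C y * MvPolynomial.X 0 - MvPolynomial.C x * MvPolynomial.X 1)
      * (MvPolynomial.C a' * MvPolynomial.X 0 - MvPolynomial.C c' * MvPolynomial.X 1) := by
    rw [toMvPolynomial, hb, ha', hc']
    simp only [map_neg, map_add, map_mul]
    ring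
  have hnu : ∀ s t : ℤ, ¬ IsUnit (MvPolynomial.C s * MvPolynomial.X 0 - MvPolynomial.C t * MvPolynomial.X 1
      : MvPolynomial (Fin 2) ℤ) := by
    intro s t h
    have := h.map (MvPolynomial.eval (fun _ : Fin 2 => (0 : ℤ)))
    simp at this
  exact (hq.isUnit_or_isUnit hfac).elim (hnu _ _) (hnu _ _)

end BinForm

lemma natCast_dvd_eval_iff_mod (q : BinForm) (e : ℕ) (v : ℤ × ℤ) :
    (e : ℤ) ∣ q.eval (v.1 % e, v.2 % e) ↔ (e : ℤ) ∣ q.eval v := by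
  have h1 : v.1 % e ≡ v.1 [ZMOD e] := Int.mod_modEq _ _
  have h2 : v.2 % e ≡ v.2 [ZMOD e] := Int.mod_modEq _ _
  have h : q.eval (v.1 % e, v.2 % e) ≡ q.eval v [ZMOD e] := by
    simp only [BinForm.eval]
    exact ((((h1.pow 2).mul_left _).add ((h1.mul_left _).mul h2)).add ((h2.pow 2).mul_left _))
  exact h.dvd_iff

/-- A form coprime to `e` has `≪ τ(e)² e` zeros modulo `e`. -/
lemma ncard_zeros_box_le (q : BinForm) {e : ℕ} (he : e ≠ 0)
    (hcop : IsCoprime (e : ℤ) (q.a * q.disc)) :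
    ({x | (e : ℤ) ∣ q.eval x} ∩ box e).ncard ≤ e.divisors.card ^ 2 * e := by
  obtain ⟨ι, _, ε, L, hcard, hε, -, hper, hm, hind⟩ := isLatticeComb_form q e he hcop
  have h1 := cast_ncard_inter_eq_sum (L := fun i => (L i : Set (ℤ × ℤ))) (ε := ε)
    (finite_box e) (fun x _ => hind x)
  -- An index divisible by `e` leaves at most `e` of the `e²` points of the box. This is the purpose
  -- of recording a divisor of the index in `IsLatticeComb`.
  have h2 : ∀ i, (((L i : Set (ℤ × ℤ)) ∩ box e).ncard) ≤ e := by
    intro i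
    have h3 := ncard_inter_box_mul_index (Nat.pos_of_ne_zero he) (hper i)
    obtain ⟨t, ht⟩ := hm i
    have ht0 : 0 < t := by
      refine Nat.pos_of_ne_zero fun h => index_ne_zero_of_periodic (Nat.pos_of_ne_zero he) (hper i) ?_
      rw [ht, h, mul_zero]
    rw [ht, sq, mul_left_comm] at h3
    have h4 := Nat.eq_of_mul_eq_mul_left (Nat.pos_of_ne_zero he) h3
    exact (Nat.le_mul_of_pos_right _ ht0).trans h4.le
  have h5 : (({x | (e : ℤ) ∣ q.eval x} ∩ box e).ncard : ℤ) ≤ (e.divisors.card ^ 2 * e : ℕ) := by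
    rw [h1]
    calc ∑ i, ε i * (((L i : Set (ℤ × ℤ)) ∩ box e).ncard : ℤ) ≤ ∑ _i : ι, (e : ℤ) := by
          refine Finset.sum_le_sum fun i _ => ?_
          calc ε i * (((L i : Set (ℤ × ℤ)) ∩ box e).ncard : ℤ)
              ≤ 1 * (((L i : Set (ℤ × ℤ)) ∩ box e).ncard : ℤ) :=
                mul_le_mul_of_nonneg_right ((le_abs_self _).trans (hε i)) (Nat.cast_nonneg _)
            _ ≤ e := by rw [one_mul]; exact_mod_cast h2 i
      _ = (Fintype.card ι * e : ℕ) := by simp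
      _ ≤ _ := by exact_mod_cast Nat.mul_le_mul_right _ hcard
  exact_mod_cast h5

open Classical in
/-- The number of vectors of bounded height at which a form is divisible by `e`. -/
lemma card_shell_filter_le (q : BinForm) {e n A : ℕ} (he : e ≠ 0)
    (hcop : IsCoprime (e : ℤ) (q.a * q.disc)) (heA : e ≤ A * n) :
    (((shell n).filter fun v => (e : ℤ) ∣ q.eval v).card : ℝ)
      ≤ (3 * A + 2) ^ 2 * n ^ 2 * ((e.divisors.card : ℝ) ^ 2 / e) := by
  have he' : (0 : ℤ) < e := by exact_mod_cast Nat.pos_of_ne_zero he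
  set K : ℕ := n / e + 1 with hK
  set Z : Set (ℤ × ℤ) := {x | (e : ℤ) ∣ q.eval x} ∩ box e with hZ
  have hZfin : Z.Finite := (finite_box e).subset Set.inter_subset_right
  let I : Finset ℤ := Finset.Icc (-(K : ℤ)) K
  have hdiv : ∀ t : ℤ, -(n : ℤ) ≤ t → t ≤ n → t / e ∈ I := by
    intro t h1 h2
    have hKn : (n : ℤ) < K * e := by
      have := Nat.lt_div_mul_add (a := n) (Nat.pos_of_ne_zero he)
      rw [hK]
      push_cast
      have h3 : (n : ℤ) < ((n / e * e + e : ℕ) : ℤ) := by exact_mod_cast this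
      push_cast at h3
      linarith
    rw [Finset.mem_Icc]
    constructor
    · rw [Int.le_ediv_iff_mul_le he']
      linarith
    · refine (Int.ediv_lt_of_lt_mul he' ?_).le
      linarith
  have hinj : ((shell n).filter fun v => (e : ℤ) ∣ q.eval v).card ≤ (hZfin.toFinset ×ˢ (I ×ˢ I)).card := by
    refine Finset.card_le_card_of_injOn
      (fun v => ((v.1 % e, v.2 % e), (v.1 / e, v.2 / e))) ?_ ?_
    · intro v hv
      rw [Finset.mem_coe, Finset.mem_filter, mem_shell] at hv
      obtain ⟨⟨-, hh⟩, hdvd⟩ := hv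
      simp only [height, max_le_iff] at hh
      simp only [Finset.coe_product, Set.mem_prod, Finset.mem_coe, Set.Finite.mem_toFinset]
      refine ⟨⟨?_, ?_⟩, hdiv _ (by omega) (by omega), hdiv _ (by omega) (by omega)⟩
      · exact (natCast_dvd_eval_iff_mod q e v).2 hdvd
      · exact ⟨⟨Int.emod_nonneg _ he'.ne', Int.emod_lt_of_pos _ he'⟩,
          ⟨Int.emod_nonneg _ he'.ne', Int.emod_lt_of_pos _ he'⟩⟩
    · intro v _ w _ hvw
      simp only [Prod.mk.injEq] at hvw
      obtain ⟨⟨h1, h2⟩, h3, h4⟩ := hvw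
      refine Prod.ext ?_ ?_
      · rw [← Int.emod_add_mul_ediv v.1 e, ← Int.emod_add_mul_ediv w.1 e, h1, h3]
      · rw [← Int.emod_add_mul_ediv v.2 e, ← Int.emod_add_mul_ediv w.2 e, h2, h4]
  have hIcard : I.card = 2 * K + 1 := by
    simp only [I, Int.card_Icc]
    omega
  have hZcard : hZfin.toFinset.card ≤ e.divisors.card ^ 2 * e := by
    rw [← Set.ncard_eq_toFinset_card Z hZfin]
    exact ncard_zeros_box_le q he hcop
  -- The blocks of side `e` covering the square have total side at most `2 n + 3 e`, and `e ≤ A n`.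
  have h6 : e * (2 * K + 1) ≤ (3 * A + 2) * n := by
    have : n / e * e ≤ n := Nat.div_mul_le_self n e
    rw [hK]
    nlinarith
  have h7 : ((shell n).filter fun v => (e : ℤ) ∣ q.eval v).card * e
      ≤ e.divisors.card ^ 2 * ((3 * A + 2) * n) ^ 2 := by
    calc _ ≤ (hZfin.toFinset ×ˢ (I ×ˢ I)).card * e := Nat.mul_le_mul_right _ hinj
      _ = hZfin.toFinset.card * ((2 * K + 1) * (2 * K + 1)) * e := by
        rw [Finset.card_product, Finset.card_product, hIcard]
      _ ≤ (e.divisors.card ^ 2 * e) * ((2 * K + 1) * (2 * K + 1)) * e := by gcongr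
      _ = e.divisors.card ^ 2 * (e * (2 * K + 1)) ^ 2 := by ring
      _ ≤ _ := by gcongr
  have he0 : (0 : ℝ) < e := by exact_mod_cast Nat.pos_of_ne_zero he
  rw [mul_div_assoc', le_div_iff₀ he0]
  have h8 : ((((shell n).filter fun v => (e : ℤ) ∣ q.eval v).card * e : ℕ) : ℝ)
      ≤ ((e.divisors.card ^ 2 * ((3 * A + 2) * n) ^ 2 : ℕ) : ℝ) := by exact_mod_cast h7
  push_cast at h8
  refine h8.trans (le_of_eq ?_)
  ring

/-- Moments of the divisor function over the values of a binary quadratic form. -/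
lemma sum_shell_copDivisors_pow_le (q : BinForm) {D : ℤ} (hD : q.a * q.disc ∣ D)
    (hq : ∀ v : ℤ × ℤ, v ≠ 0 → q.eval v ≠ 0) (g n : ℕ) :
    ∑ v ∈ shell n, (∑ d ∈ copDivisors D (q.eval v).natAbs, (d.divisors.card : ℝ) ^ 2) ^ g
      ≤ 2 ^ (3 * g) * (3 * q.size + 2) ^ 2 * n ^ 2
        * (1 + Real.log (q.size * n : ℕ)) ^ (2 ^ (12 * g + 2)) := by
  classical
  set A := q.size with hA
  have h1 : ∀ v ∈ shell n, (∑ d ∈ copDivisors D (q.eval v).natAbs, (d.divisors.card : ℝ) ^ 2) ^ g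
      ≤ 2 ^ (3 * g) * ∑ e ∈ Finset.Icc 1 (A * n), if IsCoprime (e : ℤ) D ∧ (e : ℤ) ∣ q.eval v then
          (e.divisors.card : ℝ) ^ (12 * g) else 0 := by
    intro v hv
    rw [mem_shell] at hv
    have hn0 : (q.eval v).natAbs ≠ 0 := Int.natAbs_ne_zero.2 (hq v hv.1)
    refine (sum_copDivisors_pow_le D hn0 g).trans ?_
    rw [← Finset.sum_filter]
    refine mul_le_mul_of_nonneg_left ?_ (by positivity)
    refine Finset.sum_le_sum_of_subset_of_nonneg (fun e he => ?_) fun _ _ _ => by positivity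
    rw [Finset.mem_filter, mem_copDivisors] at he
    obtain ⟨⟨⟨he1, -⟩, he2⟩, he3⟩ := he
    rw [Finset.mem_filter, Finset.mem_Icc]
    refine ⟨⟨Nat.pos_of_dvd_of_pos he1 (Nat.pos_of_ne_zero hn0), ?_⟩, he2, Int.natCast_dvd.2 he1⟩
    -- The restriction `e² ≤ |q(v)|` keeps the modulus below `A n`, as `card_shell_filter_le`
    -- requires.
    refine (Nat.pow_le_pow_iff_left two_ne_zero).1 ?_
    calc e ^ 2 ≤ (q.eval v).natAbs := he3
      _ ≤ A * height v ^ 2 := q.natAbs_eval_le v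
      _ ≤ A ^ 2 * n ^ 2 := Nat.mul_le_mul (Nat.le_self_pow two_ne_zero A) (Nat.pow_le_pow_left hv.2 2)
      _ = (A * n) ^ 2 := by ring
  have h2 : ∀ e ∈ Finset.Icc 1 (A * n),
      (∑ v ∈ shell n, if IsCoprime (e : ℤ) D ∧ (e : ℤ) ∣ q.eval v then
        (e.divisors.card : ℝ) ^ (12 * g) else 0)
      ≤ (3 * A + 2) ^ 2 * n ^ 2 * ((e.divisors.card : ℝ) ^ (12 * g + 2) / e) := by
    intro e he
    rw [Finset.mem_Icc] at he
    by_cases hc : IsCoprime (e : ℤ) D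
    · simp only [hc, true_and]
      rw [← Finset.sum_filter, Finset.sum_const, nsmul_eq_mul]
      have h3 := card_shell_filter_le q (by omega : e ≠ 0)
        (hc.of_isCoprime_of_dvd_right hD) he.2
      calc _ ≤ ((3 * A + 2) ^ 2 * n ^ 2 * ((e.divisors.card : ℝ) ^ 2 / e))
            * (e.divisors.card : ℝ) ^ (12 * g) := by gcongr
        _ = _ := by ring
    · simp only [hc, false_and, if_false, Finset.sum_const_zero]
      positivity
  calc _ ≤ ∑ v ∈ shell n, 2 ^ (3 * g) * ∑ e ∈ Finset.Icc 1 (A * n),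
          (if IsCoprime (e : ℤ) D ∧ (e : ℤ) ∣ q.eval v then
          (e.divisors.card : ℝ) ^ (12 * g) else 0) := Finset.sum_le_sum h1
    _ = 2 ^ (3 * g) * ∑ e ∈ Finset.Icc 1 (A * n), ∑ v ∈ shell n,
          (if IsCoprime (e : ℤ) D ∧ (e : ℤ) ∣ q.eval v then
          (e.divisors.card : ℝ) ^ (12 * g) else 0) := by
        rw [← Finset.mul_sum, Finset.sum_comm]
    _ ≤ 2 ^ (3 * g) * ∑ e ∈ Finset.Icc 1 (A * n),
          (3 * A + 2) ^ 2 * n ^ 2 * ((e.divisors.card : ℝ) ^ (12 * g + 2) / e) := by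
        gcongr with e he
        exact h2 e he
    _ ≤ 2 ^ (3 * g) * ((3 * A + 2) ^ 2 * n ^ 2 * (1 + Real.log (A * n : ℕ)) ^ (2 ^ (12 * g + 2))) := by
        rw [← Finset.mul_sum]
        gcongr
        exact sum_card_divisors_pow_div_le _ _
    _ = _ := by ring

/-! ### Summation over all moduli -/

/-- Partial summation over vectors of bounded height. -/
lemma sum_shell_div_height_le {W : ℤ × ℤ → ℝ} (hW : ∀ v, 0 ≤ W v) {B : ℝ} (n : ℕ)
    (h : ∀ m ≤ n, ∑ v ∈ shell m, W v ≤ B * (m : ℝ) ^ 2) :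
    ∑ v ∈ shell n, W v / height v ≤ 2 * B * n := by
  classical
  have hstep : ∀ (m : ℕ) (f : ℤ × ℤ → ℝ), ∑ v ∈ shell (m + 1), f v
      = ∑ v ∈ shell m, f v + ∑ v ∈ (shell (m + 1)).filter (fun v => height v = m + 1), f v := by
    intro m f
    have e : shell m = (shell (m + 1)).filter (fun v => ¬ height v = m + 1) := by
      ext v
      simp only [Finset.mem_filter, mem_shell]
      constructor
      · rintro ⟨h1, h2⟩
        exact ⟨⟨h1, by omega⟩, by omega⟩
      · rintro ⟨⟨h1, h2⟩, h3⟩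
        exact ⟨h1, by omega⟩
    rw [e, add_comm (∑ v ∈ _, f v), Finset.sum_filter_add_sum_filter_not]
  -- With `S(j)` the sum of `W` over `shell j`, the term `B * m` absorbs the differences `S(j) (1 /
  -- j - 1 / (j + 1))`, each at most `B` because `S(j) ≤ B j²`.
  have key : ∀ m : ℕ, m + 1 ≤ n →
      ∑ v ∈ shell (m + 1), W v / height v ≤ (∑ v ∈ shell (m + 1), W v) / (m + 1) + B * m := by
    intro m
    induction m with
    | zero =>
      intro _
      have e : ∀ v ∈ shell (0 + 1), W v / height v = W v := by
        intro v hv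
        rw [mem_shell] at hv
        have : height v ≠ 0 := fun h => hv.1 (height_eq_zero.1 h)
        have : height v = 1 := by omega
        rw [this]
        simp
      rw [Finset.sum_congr rfl e]
      simp
    | succ m ih =>
      intro hm
      have h1 := ih (by omega)
      have h2 := h (m + 1) (by omega)
      rw [hstep (m + 1), hstep (m + 1) W]
      have e : ∑ v ∈ (shell (m + 1 + 1)).filter (fun v => height v = m + 1 + 1), W v / height v
          = (∑ v ∈ (shell (m + 1 + 1)).filter (fun v => height v = m + 1 + 1), W v) / (m + 1 + 1) := by
        rw [Finset.sum_div]
        refine Finset.sum_congr rfl fun v hv => ?_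
        rw [(Finset.mem_filter.1 hv).2]
        push_cast
        rfl
      rw [e]
      set U := ∑ v ∈ shell (m + 1), W v
      have h3 : U / (m + 1) ≤ U / (m + 1 + 1) + B := by
        push_cast at h2
        have h4 : (0 : ℝ) < (m : ℝ) + 1 := by positivity
        have hU0 : 0 ≤ U := Finset.sum_nonneg fun v _ => hW v
        have hB : 0 ≤ B := by
          by_contra hB
          push Not at hB
          nlinarith [mul_pos (neg_pos.2 hB) (pow_pos h4 2)]
        rw [← sub_le_iff_le_add', div_sub_div _ _ h4.ne' (by positivity), div_le_iff₀ (by positivity)]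
        nlinarith
      push_cast
      rw [add_div]
      linarith
  rcases n with _ | m
  · have : shell 0 = ∅ := by
      ext v
      rw [mem_shell]
      simp only [Finset.notMem_empty, iff_false, not_and, Nat.le_zero]
      exact fun h1 h2 => h1 (height_eq_zero.1 h2)
    simp [this]
  · refine (key m le_rfl).trans ?_
    have h1 := h (m + 1) le_rfl
    push_cast at h1 ⊢
    have h4 : (0 : ℝ) < (m : ℝ) + 1 := by positivity
    have hU0 : 0 ≤ ∑ v ∈ shell (m + 1), W v := Finset.sum_nonneg fun v _ => hW v
    have hB : 0 ≤ B := by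
      by_contra hB
      push Not at hB
      nlinarith [mul_pos (neg_pos.2 hB) (pow_pos h4 2)]
    have h5 : (∑ v ∈ shell (m + 1), W v) / ((m : ℝ) + 1) ≤ B * (m + 1) := by
      rw [div_le_iff₀ h4]
      linarith
    linarith

lemma mem_moduli {g : ℕ} {D : ℤ} {Q : Fin g → ℝ} {d : Fin g → ℕ} : d ∈ moduli D Q ↔
    (∀ i, d i ∈ Finset.Icc 1 ⌊Q i⌋₊) ∧ ∀ i, IsCoprime (d i : ℤ) D := by
  rw [moduli, Finset.mem_filter, Fintype.mem_piFinset]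

lemma dvd_bigD {g : ℕ} (q : Fin g → BinForm) (i : Fin g) :
    (q i).a * (q i).c * (q i).disc ∣ bigD q := by
  rw [bigD]
  exact ((Finset.dvd_prod_of_mem (fun k => (q k).a * (q k).c * (q k).disc)
    (Finset.mem_univ i)).mul_left _).mul_right _

-- If `Λ_d` has a nonzero vector of height at most `n`, the least such height serves as `l` and its
-- reciprocal is a term of the sum; otherwise `l = n` serves. Unlike `1 / l`, the resulting bound is
-- a sum over `v`, which can be exchanged with the sum over `d`.
open Classical in
lemma err_le_sum_shell {g : ℕ} (q : Fin g → BinForm) (z : ℤ × ℤ) (d : Fin g → ℕ)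
    (hd0 : ∀ i, d i ≠ 0) (hD : bigD q ≠ 0) (hd : ∀ i, IsCoprime (d i : ℤ) (bigD q)) {M : ℝ}
    (hM : 0 ≤ M) {n : ℕ} (hn : 0 < n) {R : Set (EuclideanSpace ℝ (Fin 2))} (hR : R ∈ regions M) :
    err q z d R ≤ (∏ i, ((d i).divisors.card : ℝ) ^ 2) * (9 + 18 * M * (1 / n
      + ∑ v ∈ shell n, if v ∈ Lam q d then (1 : ℝ) / height v else 0)) := by
  have hd' : ∀ i, IsCoprime (d i : ℤ) ((q i).a * (q i).disc) := fun i =>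
    (hd i).of_isCoprime_of_dvd_right
      ((Dvd.intro (q i).c (by ring)).trans (dvd_bigD q i))
  have hcast : ∀ v : ℤ × ℤ, ((height v : ℝ)) ^ 2 ≤ (dotp v v : ℝ) := fun v => by
    exact_mod_cast height_sq_le_dotp v
  have hnn : ∀ v ∈ shell n, (0 : ℝ) ≤ if v ∈ Lam q d then (1 : ℝ) / height v else 0 := fun v _ => by
    positivity
  obtain ⟨l, hl, hmin, hbound⟩ : ∃ l : ℝ, 0 < l ∧ (∀ x ∈ Lam q d, x ≠ 0 → l ^ 2 ≤ (dotp x x : ℝ)) ∧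
      1 / l ≤ 1 / n + ∑ v ∈ shell n, if v ∈ Lam q d then (1 : ℝ) / height v else 0 := by
    have hn' : (0 : ℝ) < n := by exact_mod_cast hn
    by_cases hne : ((shell n).filter (· ∈ Lam q d)).Nonempty
    · obtain ⟨v, hv, hvmin⟩ := Finset.exists_min_image _ height hne
      rw [Finset.mem_filter] at hv
      have hv' := mem_shell.1 hv.1
      have hpos : 0 < height v := Nat.pos_of_ne_zero fun h => hv'.1 (height_eq_zero.1 h)
      refine ⟨height v, by exact_mod_cast hpos, fun x hx hx0 => ?_, ?_⟩
      · refine le_trans ?_ (hcast x)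
        gcongr
        by_cases hxn : height x ≤ n
        · exact hvmin x (Finset.mem_filter.2 ⟨mem_shell.2 ⟨hx0, hxn⟩, hx⟩)
        · omega
      · have h1 := Finset.single_le_sum hnn hv.1
        rw [if_pos hv.2] at h1
        have : (0 : ℝ) ≤ 1 / n := by positivity
        linarith
    · refine ⟨n, hn', fun x hx hx0 => ?_, ?_⟩
      · refine le_trans ?_ (hcast x)
        gcongr
        by_contra hxn
        exact hne ⟨x, Finset.mem_filter.2 ⟨mem_shell.2 ⟨hx0, by omega⟩, hx⟩⟩
      · linarith [Finset.sum_nonneg hnn]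
  refine (err_le q z d hd0 hD hd hd' hM hl hmin hR).trans ?_
  refine mul_le_mul_of_nonneg_left ?_ (by positivity)
  have : 9 * (2 / l * M) = 18 * M * (1 / l) := by ring
  rw [this, add_comm]
  gcongr

lemma sum_moduli_prod_le {g : ℕ} (D : ℤ) {Q : Fin g → ℝ} (hQ : ∀ i, 1 ≤ Q i) :
    ∑ d ∈ moduli D Q, ∏ i, ((d i).divisors.card : ℝ) ^ 2
      ≤ (∏ i, Q i) * (1 + Real.log (∏ i, Q i)) ^ (4 * g) := by
  calc ∑ d ∈ moduli D Q, ∏ i, ((d i).divisors.card : ℝ) ^ 2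
      ≤ ∑ d ∈ Fintype.piFinset fun i => Finset.Icc 1 ⌊Q i⌋₊, ∏ i, ((d i).divisors.card : ℝ) ^ 2 :=
        Finset.sum_le_sum_of_subset_of_nonneg (Finset.filter_subset _ _) fun _ _ _ => by positivity
    _ = ∏ i, ∑ n ∈ Finset.Icc 1 ⌊Q i⌋₊, (n.divisors.card : ℝ) ^ 2 :=
        (Finset.prod_univ_sum (fun i => Finset.Icc 1 ⌊Q i⌋₊)
          (fun _ n => (n.divisors.card : ℝ) ^ 2)).symm
    _ ≤ ∏ i, (Q i * (1 + Real.log (∏ i, Q i)) ^ 4) := by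
        refine Finset.prod_le_prod (fun _ _ => by positivity) fun i _ => ?_
        have hQi : (0 : ℝ) < Q i := zero_lt_one.trans_le (hQ i)
        have h1 : (1 : ℝ) ≤ ⌊Q i⌋₊ := by exact_mod_cast Nat.le_floor (by simpa using hQ i)
        have h2 : (⌊Q i⌋₊ : ℝ) ≤ Q i := Nat.floor_le hQi.le
        have h3 : Q i ≤ ∏ i, Q i := by
          rw [← Finset.mul_prod_erase _ _ (Finset.mem_univ i)]
          exact le_mul_of_one_le_right hQi.le (Finset.one_le_prod fun j _ => hQ j)
        refine (sum_card_divisors_pow_le 2 _).trans ?_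
        have h4 : 0 ≤ Real.log (⌊Q i⌋₊ : ℝ) := Real.log_nonneg h1
        have h5 : Real.log (⌊Q i⌋₊ : ℝ) ≤ Real.log (∏ i, Q i) :=
          Real.log_le_log (by linarith) (h2.trans h3)
        norm_num only
        gcongr
    _ = _ := by
        rw [Finset.prod_mul_distrib, Finset.prod_const, Finset.card_univ, Fintype.card_fin, ← pow_mul]

-- For fixed `v` each `d i` is a divisor of `q_i(v)`, so the sum is at most a product over `i`.
-- Bounding the product by the `g`-th power of its largest factor, and that by the sum of all `g`-th
-- powers, separates the forms.
open Classical in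
lemma sum_moduli_mem_Lam_le {g : ℕ} (hg : 1 ≤ g) (q : Fin g → BinForm) (D : ℤ) (Q : Fin g → ℝ)
    {v : ℤ × ℤ} (hv : ∀ i, (q i).eval v ≠ 0) :
    ∑ d ∈ (moduli D Q).filter (fun d => v ∈ Lam q d), ∏ i, ((d i).divisors.card : ℝ) ^ 2
      ≤ ∑ i, (∑ d ∈ copDivisors D ((q i).eval v).natAbs, (d.divisors.card : ℝ) ^ 2) ^ g := by
  set G : Fin g → ℝ := fun i =>
    ∑ d ∈ copDivisors D ((q i).eval v).natAbs, (d.divisors.card : ℝ) ^ 2 with hG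
  have hG0 : ∀ i, 0 ≤ G i := fun i => Finset.sum_nonneg fun _ _ => sq_nonneg _
  calc _ ≤ ∑ d ∈ Fintype.piFinset fun i => copDivisors D ((q i).eval v).natAbs,
          ∏ i, ((d i).divisors.card : ℝ) ^ 2 := by
        refine Finset.sum_le_sum_of_subset_of_nonneg (fun d hd => ?_) fun _ _ _ =>
          Finset.prod_nonneg fun _ _ => sq_nonneg _
        rw [Finset.mem_filter, mem_moduli] at hd
        rw [Fintype.mem_piFinset]
        intro i
        rw [mem_copDivisors]
        exact ⟨⟨Int.natCast_dvd.1 (hd.2 i), Int.natAbs_ne_zero.2 (hv i)⟩, hd.1.2 i⟩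
    _ = ∏ i, G i := (Finset.prod_univ_sum (fun i => copDivisors D ((q i).eval v).natAbs)
          (fun _ n => (n.divisors.card : ℝ) ^ 2)).symm
    _ ≤ ∑ i, G i ^ g := by
        have : Nonempty (Fin g) := ⟨⟨0, hg⟩⟩
        obtain ⟨j, hj⟩ := Finite.exists_max G
        calc ∏ i, G i ≤ ∏ _i : Fin g, G j := Finset.prod_le_prod (fun i _ => hG0 i) fun i _ => hj i
          _ = G j ^ g := by simp
          _ ≤ _ := Finset.single_le_sum (f := fun i => G i ^ g)
            (fun i _ => pow_nonneg (hG0 i) g) (Finset.mem_univ j)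

lemma sum_shell_copDivisors_pow_le_of_le (q : BinForm) {D : ℤ} (hD : q.a * q.disc ∣ D)
    (hq : ∀ v : ℤ × ℤ, v ≠ 0 → q.eval v ≠ 0) (g : ℕ) {m n A : ℕ} (hm : m ≤ n) (hA : q.size ≤ A) :
    ∑ v ∈ shell m, (∑ d ∈ copDivisors D (q.eval v).natAbs, (d.divisors.card : ℝ) ^ 2) ^ g
      ≤ (2 ^ (3 * g) * (3 * A + 2) ^ 2 * (1 + Real.log (A * n : ℕ)) ^ (2 ^ (12 * g + 2)))
        * (m : ℝ) ^ 2 := by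
  refine (sum_shell_copDivisors_pow_le q hD hq g m).trans ?_
  have h7 : (0 : ℝ) ≤ Real.log (q.size * m : ℕ) := Real.log_natCast_nonneg _
  have h8 : Real.log (q.size * m : ℕ) ≤ Real.log (A * n : ℕ) := by
    rcases Nat.eq_zero_or_pos (q.size * m) with h | h
    · rw [h, Nat.cast_zero, Real.log_zero]
      exact Real.log_natCast_nonneg _
    · refine Real.log_le_log (by exact_mod_cast h) ?_
      exact_mod_cast Nat.mul_le_mul hA hm
  have h9 : (q.size : ℝ) ≤ A := by exact_mod_cast hA
  calc _ ≤ 2 ^ (3 * g) * (3 * (A : ℝ) + 2) ^ 2 * (m : ℝ) ^ 2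
        * (1 + Real.log (A * n : ℕ)) ^ (2 ^ (12 * g + 2)) := by gcongr
    _ = _ := by ring

/-- The sum over all moduli of the bound for the error term. -/
lemma T_le {g : ℕ} (hg : 1 ≤ g) (q : Fin g → BinForm) (hirr : ∀ i, Irreducible (q i).toMvPolynomial)
    (hD : bigD q ≠ 0) (z : ℤ × ℤ) {M : ℝ} (hM : 0 ≤ M) {Q : Fin g → ℝ} (hQ : ∀ i, 1 ≤ Q i)
    {n A : ℕ} (hn : 0 < n) (hA : ∀ i, (q i).size ≤ A) :
    T q z M Q ≤ ENNReal.ofReal ((9 + 18 * M / n) * ((∏ i, Q i) * (1 + Real.log (∏ i, Q i)) ^ (4 * g))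
      + 18 * M * (2 * (g * (2 ^ (3 * g) * (3 * A + 2) ^ 2
        * (1 + Real.log (A * n : ℕ)) ^ (2 ^ (12 * g + 2)))) * n)) := by
  classical
  have hac : ∀ i, (q i).a ≠ 0 ∧ (q i).c ≠ 0 := by
    intro i
    constructor
    · intro h
      have := dvd_bigD q i
      rw [h] at this
      simp only [zero_mul, zero_dvd_iff] at this
      exact hD this
    · intro h
      have := dvd_bigD q i
      rw [h] at this
      simp only [mul_zero, zero_mul, zero_dvd_iff] at this
      exact hD this
  have hne : ∀ i, ∀ v : ℤ × ℤ, v ≠ 0 → (q i).eval v ≠ 0 := fun i v hv =>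
    BinForm.eval_ne_zero (hirr i) (hac i).1 (hac i).2 hv
  set P : (Fin g → ℕ) → ℝ := fun d => ∏ i, ((d i).divisors.card : ℝ) ^ 2 with hP
  have hP0 : ∀ d, 0 ≤ P d := fun d => Finset.prod_nonneg fun _ _ => sq_nonneg _
  set I : (Fin g → ℕ) → ℝ := fun d =>
    ∑ v ∈ shell n, if v ∈ Lam q d then (1 : ℝ) / height v else 0 with hI
  have hI0 : ∀ d, 0 ≤ I d := fun d => Finset.sum_nonneg fun v _ => by
    split_ifs
    · exact div_nonneg zero_le_one (Nat.cast_nonneg _)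
    · exact le_rfl
  have hM18 : 0 ≤ 18 * M := mul_nonneg (by norm_num) hM
  have h1 : T q z M Q ≤ ∑ d ∈ moduli (bigD q) Q,
      ENNReal.ofReal (P d * (9 + 18 * M * (1 / n + I d))) := by
    refine Finset.sum_le_sum fun d hd => iSup₂_le fun R hR => ENNReal.ofReal_le_ofReal ?_
    rw [mem_moduli] at hd
    exact err_le_sum_shell q z d (fun i => by have := Finset.mem_Icc.1 (hd.1 i); omega) hD hd.2 hM hn hR
  refine h1.trans ?_
  have hnn : ∀ d ∈ moduli (bigD q) Q, 0 ≤ P d * (9 + 18 * M * (1 / n + I d)) := fun d _ =>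
    mul_nonneg (hP0 d) (add_nonneg (by norm_num) (mul_nonneg hM18
      (add_nonneg (div_nonneg zero_le_one (Nat.cast_nonneg _)) (hI0 d))))
  rw [← ENNReal.ofReal_sum_of_nonneg hnn]
  refine ENNReal.ofReal_le_ofReal ?_
  have h2 : ∑ d ∈ moduli (bigD q) Q, P d * (9 + 18 * M * (1 / n + I d))
      = (9 + 18 * M / n) * ∑ d ∈ moduli (bigD q) Q, P d
        + 18 * M * ∑ d ∈ moduli (bigD q) Q, P d * I d := by
    rw [Finset.mul_sum, Finset.mul_sum, ← Finset.sum_add_distrib]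
    refine Finset.sum_congr rfl fun d _ => ?_
    ring
  rw [h2]
  have hsum := sum_moduli_prod_le (bigD q) hQ
  set W : ℤ × ℤ → ℝ := fun v =>
    ∑ i, (∑ d ∈ copDivisors (bigD q) ((q i).eval v).natAbs, (d.divisors.card : ℝ) ^ 2) ^ g with hW
  have hW0 : ∀ v, 0 ≤ W v := fun v => Finset.sum_nonneg fun _ _ =>
    pow_nonneg (Finset.sum_nonneg fun _ _ => sq_nonneg _) g
  have h3 : ∑ d ∈ moduli (bigD q) Q, P d * I d ≤ ∑ v ∈ shell n, W v / height v := by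
    simp only [hI, Finset.mul_sum]
    rw [Finset.sum_comm]
    refine Finset.sum_le_sum fun v hv => ?_
    have h4 := sum_moduli_mem_Lam_le hg q (bigD q) Q (v := v) fun i => hne i v (mem_shell.1 hv).1
    calc ∑ d ∈ moduli (bigD q) Q, P d * (if v ∈ Lam q d then (1 : ℝ) / height v else 0)
        = (∑ d ∈ (moduli (bigD q) Q).filter (fun d => v ∈ Lam q d), P d) / height v := by
          rw [Finset.sum_filter, Finset.sum_div]
          refine Finset.sum_congr rfl fun d _ => ?_
          split_ifs
          · ring
          · simp
      _ ≤ W v / height v := div_le_div_of_nonneg_right h4 (Nat.cast_nonneg _)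
  have h5 : ∑ v ∈ shell n, W v / height v ≤ 2 * (g * (2 ^ (3 * g) * (3 * A + 2) ^ 2
        * (1 + Real.log (A * n : ℕ)) ^ (2 ^ (12 * g + 2)))) * n := by
    refine sum_shell_div_height_le hW0 n fun m hm => ?_
    simp only [hW]
    rw [Finset.sum_comm]
    have h6 : ∀ i ∈ (Finset.univ : Finset (Fin g)),
        ∑ v ∈ shell m, (∑ d ∈ copDivisors (bigD q) ((q i).eval v).natAbs, (d.divisors.card : ℝ) ^ 2) ^ g
        ≤ (2 ^ (3 * g) * (3 * A + 2) ^ 2 * (1 + Real.log (A * n : ℕ)) ^ (2 ^ (12 * g + 2)))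
          * (m : ℝ) ^ 2 := by
      intro i _
      exact sum_shell_copDivisors_pow_le_of_le (q i) ((Dvd.intro (q i).c (by ring)).trans (dvd_bigD q i))
        (hne i) g hm (hA i)
    refine (Finset.sum_le_sum h6).trans (le_of_eq ?_)
    rw [Finset.sum_const, Finset.card_univ, Fintype.card_fin, nsmul_eq_mul]
    ring
  exact add_le_add (mul_le_mul_of_nonneg_left hsum
    (add_nonneg (by norm_num) (div_nonneg hM18 (Nat.cast_nonneg _))))
    (mul_le_mul_of_nonneg_left (h3.trans h5) hM18)

end LevelOfDistribution

/-! ### Choice of the parameters -/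

theorem theorem2 (g : ℕ) (hg : 1 ≤ g) :
    ∃ ν₁ ν₂ : ℝ, 1 < ν₁ ∧ 1 < ν₂ ∧
      ∀ q : Fin g → LevelOfDistribution.BinForm,
        (∀ i, Irreducible (q i).toMvPolynomial) →
        (∀ i, (q i).a ≡ 1 [ZMOD 4]) →
        LevelOfDistribution.bigD q ≠ 0 →
        ∃ C : ℝ, 0 < C ∧
          ∀ z : ℤ × ℤ, (∀ i, IsCoprime ((q i).eval z) (LevelOfDistribution.bigD q)) →
          ∀ (M : ℝ) (Q : Fin g → ℝ), 1 ≤ M → (∀ i, 1 ≤ Q i) →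
            LevelOfDistribution.T q z M Q ≤
              ENNReal.ofReal (C * ((∏ i, Q i) * (Real.log (2 * ∏ i, Q i)) ^ ν₁
                + M * Real.sqrt (∏ i, Q i) * (Real.log (2 * ∏ i, Q i)) ^ ν₂)) := by
  set k : ℕ := 2 ^ (12 * g + 2) with hk
  have hgk : 4 * g ≤ k := by
    have : 12 * g + 2 < k := Nat.lt_two_pow_self
    omega
  refine ⟨(4 * g : ℕ), k, ?_, ?_, ?_⟩
  · exact_mod_cast (by omega : 1 < 4 * g)
  · exact_mod_cast (by omega : 1 < k)
  intro q hirr _ hD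
  set A : ℕ := 1 + ∑ i, (q i).size with hA
  have hA1 : (1 : ℝ) ≤ A := by exact_mod_cast Nat.le_add_right 1 _
  have hlogA : 0 ≤ Real.log A := Real.log_nonneg hA1
  -- From `1 ≤ 2 ℓ` and `log n ≤ ℓ` it follows that `1 + log A + log n ≤ (3 + 2 log A) ℓ`.
  set c₁ : ℝ := 3 + 2 * Real.log A with hc₁
  set c₂ : ℝ := g * (2 ^ (3 * g) * (3 * A + 2) ^ 2 * c₁ ^ k) with hc₂
  have hc₁0 : 0 < c₁ := by positivity
  have hc₂0 : 0 ≤ c₂ := by positivity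
  refine ⟨9 * 2 ^ (4 * g) + 18 * 2 ^ k + 72 * c₂, by positivity, ?_⟩
  intro z _ M Q hM hQ
  set X : ℝ := ∏ i, Q i with hX
  have hX1 : 1 ≤ X := Finset.one_le_prod fun i _ => hQ i
  have hX0 : 0 < X := by linarith
  set ℓ : ℝ := Real.log (2 * X) with hℓ
  have hℓeq : ℓ = Real.log 2 + Real.log X := Real.log_mul (by norm_num) hX0.ne'
  have hlogX : 0 ≤ Real.log X := Real.log_nonneg hX1
  have hlog2 : (1 : ℝ) / 2 < Real.log 2 := by linarith [Real.log_two_gt_d9]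
  have hℓ1 : 1 + Real.log X ≤ 2 * ℓ := by linarith
  have hℓ0 : 0 < ℓ := by linarith
  rw [Real.rpow_natCast, Real.rpow_natCast]
  -- This cutoff makes both `X / n` and `n` of order `√X`, balancing long shortest vectors against
  -- short ones.
  set n : ℕ := ⌈√X⌉₊ with hn
  have hsq1 : 1 ≤ √X := Real.one_le_sqrt.2 hX1
  have hsqX : √X * √X = X := Real.mul_self_sqrt hX0.le
  have hn1 : √X ≤ n := Nat.le_ceil _
  have hn2 : (n : ℝ) ≤ 2 * √X := by
    have := Nat.ceil_lt_add_one (Real.sqrt_nonneg X)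
    linarith
  have hn0 : 0 < n := Nat.ceil_pos.2 (by linarith)
  have hn0' : (0 : ℝ) < n := by exact_mod_cast hn0
  refine (LevelOfDistribution.T_le hg q hirr hD z (by linarith) hQ hn0 (A := A) (fun i => ?_)).trans (ENNReal.ofReal_le_ofReal ?_)
  · exact (Finset.single_le_sum (f := fun i => (q i).size) (fun _ _ => Nat.zero_le _)
      (Finset.mem_univ i)).trans (by omega)
  have hlogn : 1 + Real.log (A * n : ℕ) ≤ c₁ * ℓ := by
    push_cast
    rw [Real.log_mul (by linarith) hn0'.ne']
    have h1 : Real.log n ≤ ℓ := by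
      refine Real.log_le_log hn0' (hn2.trans ?_)
      nlinarith
    nlinarith
  have hlogn0 : 0 ≤ 1 + Real.log (A * n : ℕ) := by
    have := Real.log_natCast_nonneg (A * n)
    linarith
  have hpow1 : (1 + Real.log X) ^ (4 * g) ≤ 2 ^ (4 * g) * ℓ ^ (4 * g) := by
    rw [← mul_pow]
    gcongr
  have hpow2 : (1 + Real.log X) ^ (4 * g) ≤ 2 ^ k * ℓ ^ k := by
    rw [← mul_pow]
    exact (pow_le_pow_left₀ (by positivity) hℓ1 _).trans (pow_le_pow_right₀ (by linarith) hgk)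
  have hpow3 : (1 + Real.log (A * n : ℕ)) ^ k ≤ c₁ ^ k * ℓ ^ k := by
    rw [← mul_pow]
    gcongr
  have hXn : X / n ≤ √X := by
    rw [div_le_iff₀ hn0']
    calc X = √X * √X := hsqX.symm
      _ ≤ √X * n := by gcongr
  have hM0 : 0 ≤ M := by linarith
  have t1 : 9 * (X * (1 + Real.log X) ^ (4 * g)) ≤ 9 * 2 ^ (4 * g) * (X * ℓ ^ (4 * g)) := by
    calc 9 * (X * (1 + Real.log X) ^ (4 * g)) ≤ 9 * (X * (2 ^ (4 * g) * ℓ ^ (4 * g))) := by gcongr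
      _ = _ := by ring
  have t2 : 18 * M / n * (X * (1 + Real.log X) ^ (4 * g)) ≤ 18 * 2 ^ k * (M * √X * ℓ ^ k) := by
    calc 18 * M / n * (X * (1 + Real.log X) ^ (4 * g))
        = 18 * M * (X / n) * (1 + Real.log X) ^ (4 * g) := by ring
      _ ≤ 18 * M * √X * (2 ^ k * ℓ ^ k) := by gcongr
      _ = _ := by ring
  have t3 : 18 * M * (2 * (g * (2 ^ (3 * g) * (3 * A + 2) ^ 2
      * (1 + Real.log (A * n : ℕ)) ^ k)) * n) ≤ 72 * c₂ * (M * √X * ℓ ^ k) := by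
    calc _ ≤ 18 * M * (2 * (g * (2 ^ (3 * g) * (3 * A + 2) ^ 2 * (c₁ ^ k * ℓ ^ k))) * (2 * √X)) := by
          gcongr
      _ = _ := by rw [hc₂]; ring
  have u1 : 0 ≤ X * ℓ ^ (4 * g) := by positivity
  have u2 : 0 ≤ M * √X * ℓ ^ k := by positivity
  have u3 : (0 : ℝ) ≤ 18 * 2 ^ k + 72 * c₂ := by positivity
  have u4 : (0 : ℝ) ≤ 9 * 2 ^ (4 * g) := by positivity
  calc _ = 9 * (X * (1 + Real.log X) ^ (4 * g)) + 18 * M / n * (X * (1 + Real.log X) ^ (4 * g))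
        + 18 * M * (2 * (g * (2 ^ (3 * g) * (3 * A + 2) ^ 2
          * (1 + Real.log (A * n : ℕ)) ^ k)) * n) := by ring
    _ ≤ 9 * 2 ^ (4 * g) * (X * ℓ ^ (4 * g)) + 18 * 2 ^ k * (M * √X * ℓ ^ k)
        + 72 * c₂ * (M * √X * ℓ ^ k) := add_le_add (add_le_add t1 t2) t3
    _ ≤ (9 * 2 ^ (4 * g) + 18 * 2 ^ k + 72 * c₂) * (X * ℓ ^ (4 * g) + M * √X * ℓ ^ k) := by
        have v1 := mul_nonneg u3 u1
        have v2 := mul_nonneg u4 u2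
        linarith [v1, v2]
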